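/- **Theorem.** Let $\Delta>0$, $\sigma_u>0$, $\Sigma_0>0$, and let $N\ge 1$ be the number of trading times. Kyle's equilibrium is the unique solution $(\hat\lambda_n,\hat\Sigma_n,\hat\alpha_n,\hat\beta_n)_{n=1,\dots,N}$, with $\Sigma_0$ given and $\alpha_N:=0$, of $$\lambda_n=\frac{\beta_n\Sigma_{n-1}}{\beta_n^2\Sigma_{n-1}\Delta+\sigma_u^2},\quad \Sigma_n=\frac{\Sigma_{n-1}\sigma_u^2}{\beta_n^2\Sigma_{n-1}\Delta+\sigma_u^2},\quad \alpha_{n-1}=\frac{1}{4\lambda_n(1-\alpha_n\lambda_n)},\quad \beta_n=\frac{1-2\alpha_n\lambda_n}{2\Delta\lambda_n(1-\alpha_n\lambda_n)},\qquad n=1,\dots,N,$$ such that $\beta_n>0$ and $\alpha_n\lambda_n<1$ for all $n$. Let $\vec{\hat\lambda}=(\hat\lambda_1,\dots,\hat\lambda_N)'$. Define the map $S$ as follows. For $\vec\lambda\in\mathbb R^N$ put $\alpha_N:=0$ and, for $n=N,\dots,1$, $$\beta_n:=\frac{1-2\alpha_n\lambda_n}{2\Delta\lambda_n(1-\alpha_n\lambda_n)},\qquad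 \alpha_{n-1}:=\frac{1}{4\lambda_n(1-\alpha_n\lambda_n)};$$ $\operatorname{dom}(S)$ is the set of $\vec\lambda$ for which all these denominators are nonzero. For $\vec\lambda\in\operatorname{dom}(S)$ put $\Sigma'_0:=\Sigma_0$ and, for $n=1,\dots,N$, $$\lambda'_n:=\frac{\beta_n\Sigma'_{n-1}}{\beta_n^2\Sigma'_{n-1}\Delta+\sigma_u^2},\qquad \Sigma'_n:=\frac{\Sigma'_{n-1}\sigma_u^2}{\beta_n^2\Sigma'_{n-1}\Delta+\sigma_u^2},\qquad S(\vec\lambda):=(\lambda'_1,\dots,\lambda'_N)'.$$ Outside $\operatorname{dom}(S)$ set $S:=\infty$. Given $\vec\lambda^{(0)}\in\operatorname{dom}(S)$, let $\vec\lambda^{(m+1)}:=S(\vec\lambda^{(m)})$; the sequence is said to converge to $\vec{\hat\lambda}$ if it never leaves $\operatorname{dom}(S)$ and $\lim_{m\to\infty}\vec\lambda^{(m)}=\vec{\hat\lambda}$. Kyle's equilibrium is called *locally stable* with respect to policy iterations for the market makers if there is $\epsilon>0$ such that for every $\vec\lambda^{(0)}\in\operatorname{dom}(S)$ with $0<|\vec\lambda^{(0)}-\vec{\hat\lambda}|<\epsilon$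 (Euclidean norm) the sequence converges to $\vec{\hat\lambda}$. It is called *unstable* if $\vec\lambda^{(0)}=\vec{\hat\lambda}$ is the only starting policy for which the sequence converges to $\vec{\hat\lambda}$. Then: 1. For $N\in\{1,2\}$, Kyle's equilibrium is locally stable with respect to policy iterations for the market makers. 2. For $N\ge 3$, Kyle's equilibrium is not locally stable with respect to policy iterations for the market makers. 3. For $N\ge 3$, Kyle's equilibrium is not unstable with respect to policy iterations for the market makers. -/

import Mathlib

/-- Coefficients of a linear pricing rule / trading strategy with `N` trading times. The index
`i : Fin N` stands for the trading time `n = i + 1`; the indices `0, …, N` of `Sig` and `alp` are the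
elements of `Fin (N + 1)`, so that for `i : Fin N` (time `n`), `i.castSucc` is `n - 1` and `i.succ`
is `n`. -/
@[ext]
structure KyleCoeffs (N : ℕ) where
  /-- price impact coefficients `λ₁, …, λ_N` -/
  lam : EuclideanSpace ℝ (Fin N)
  /-- posterior variances `Σ₀, …, Σ_N` -/
  Sig : Fin (N + 1) → ℝ
  /-- value function coefficients `α₀, …, α_N` -/
  alp : Fin (N + 1) → ℝ
  /-- trading intensities `β₁, …, β_N` -/
  bet : EuclideanSpace ℝ (Fin N)

/-- Kyle's system of equations for the coefficients of the linear equilibrium, where `Δ` is the time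
step, `σ ^ 2 * Δ` the variance of the noise traders' orders, and `S0` the variance of the liquidating
value. The trading intensities are positive, and the second-order condition `αₙ λₙ < 1` holds. -/
structure IsKyleEquilibrium {N : ℕ} (Δ σ S0 : ℝ) (e : KyleCoeffs N) : Prop where
  Sig_zero : e.Sig 0 = S0
  alp_last : e.alp (Fin.last N) = 0
  lam_eq : ∀ i : Fin N, e.lam i =
    e.bet i * e.Sig i.castSucc / (e.bet i ^ 2 * e.Sig i.castSucc * Δ + σ ^ 2)
  Sig_eq : ∀ i : Fin N, e.Sig i.succ =
    e.Sig i.castSucc * σ ^ 2 / (e.bet i ^ 2 * e.Sig i.castSucc * Δ + σ ^ 2)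
  alp_eq : ∀ i : Fin N, e.alp i.castSucc =
    1 / (4 * e.lam i * (1 - e.alp i.succ * e.lam i))
  bet_eq : ∀ i : Fin N, e.bet i =
    (1 - 2 * e.alp i.succ * e.lam i) / (Δ * 2 * e.lam i * (1 - e.alp i.succ * e.lam i))
  bet_pos : ∀ i : Fin N, 0 < e.bet i
  second_order : ∀ i : Fin N, e.alp i.succ * e.lam i < 1

theorem kyle_root_exists (t : ℝ) (ht : 0 < t) :
    ∃ a : ℝ, 0 < a ∧ a < 1 ∧ a = t * ((1 - a) ^ 2 * (1 + a)) := by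
  have hc : ContinuousOn (fun a : ℝ => a - t * ((1 - a) ^ 2 * (1 + a))) (Set.Icc 0 1) := by
    fun_prop
  have h := intermediate_value_Ioo (zero_le_one) hc
  have h0 : (0 : ℝ) ∈ Set.Ioo ((0 : ℝ) - t * ((1 - 0) ^ 2 * (1 + 0)))
      (1 - t * ((1 - 1) ^ 2 * (1 + 1))) := by
    constructor
    · simp only [sub_zero, one_pow, add_zero, mul_one, zero_sub]; linarith
    · norm_num
  obtain ⟨a, ha, hfa⟩ := h h0
  exact ⟨a, ha.1, ha.2, by simp only at hfa; linarith⟩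

theorem kyle_root_le {t a b : ℝ} (ht : 0 < t) (ha0 : 0 < a)
    (ha : a = t * ((1 - a) ^ 2 * (1 + a))) (hb1 : b < 1)
    (hb : b = t * ((1 - b) ^ 2 * (1 + b))) : b ≤ a := by
  by_contra! h
  have h1 : (1 - b) * (1 - b ^ 2) ≤ (1 - a) * (1 - a ^ 2) := by
    apply mul_le_mul <;> nlinarith
  have h2 := mul_le_mul_of_nonneg_left h1 ht.le
  nlinarith

/-- The squared rescaled intensities, counted backwards from the last trading time. -/
theorem kyle_sequence_exists : ∃ A : ℕ → ℝ, A 0 = 1 ∧ (∀ k, 0 < A k) ∧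
    ∀ k, A (k + 1) < 1 ∧ A (k + 1) = A k * ((1 - A (k + 1)) ^ 2 * (1 + A (k + 1))) := by
  choose g hg0 hg1 hg using fun t : {t : ℝ // 0 < t} => kyle_root_exists t.1 t.2
  let B : ℕ → {t : ℝ // 0 < t} := fun k => Nat.rec ⟨1, one_pos⟩ (fun _ t => ⟨g t, hg0 t⟩) k
  exact ⟨fun k => (B k).1, rfl, fun k => (B k).2, fun k => ⟨hg1 (B k), hg (B k)⟩⟩

theorem kyle_exists (N : ℕ) {Δ σ S0 : ℝ} (hΔ : 0 < Δ) (hσ : 0 < σ) (hS : 0 < S0) :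
    ∃ e : KyleCoeffs N, IsKyleEquilibrium Δ σ S0 e := by
  obtain ⟨A, hA0, hAp, hA⟩ := kyle_sequence_exists
  let a : ℕ → ℝ := fun k => A (N - 1 - k)
  let s : ℕ → ℝ := fun k => Nat.rec S0 (fun i x => x / (1 + a i)) k
  have hap : ∀ k, 0 < a k := fun k => hAp _
  have hsp : ∀ k, 0 < s k := by
    intro k
    induction k with
    | zero => exact hS
    | succ k ih => exact div_pos ih (by linarith [hap k])
  have hss : ∀ k, s (k + 1) = s k / (1 + a k) := fun k => rfl
  let b : ℕ → ℝ := fun k => σ * √(a k / (s k * Δ))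
  have hbp : ∀ k, 0 < b k := fun k =>
    mul_pos hσ (Real.sqrt_pos.2 (div_pos (hap k) (mul_pos (hsp k) hΔ)))
  have hb : ∀ k, b k ^ 2 * s k * Δ = a k * σ ^ 2 := by
    intro k
    have h1 := (hsp k).ne'
    have h2 := hΔ.ne'
    simp only [b]
    rw [mul_pow, Real.sq_sqrt (div_pos (hap k) (mul_pos (hsp k) hΔ)).le]
    field_simp
  let l : ℕ → ℝ := fun k => b k * s k / (b k ^ 2 * s k * Δ + σ ^ 2)
  have hl : ∀ k, l k = b k * s k / (σ ^ 2 * (1 + a k)) := by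
    intro k
    simp only [l]
    rw [hb]
    congr 1
    ring
  have hlp : ∀ k, 0 < l k := by
    intro k
    rw [hl]
    have := hap k
    have := hbp k
    have := hsp k
    positivity
  have hx : ∀ k, k < N →
      (if k + 1 < N then 1 / (2 * l (k + 1) * (1 + a (k + 1))) else 0) * l k = (1 - a k) / 2 := by
    intro k hk
    split_ifs with h
    · have hr := hA (N - 1 - (k + 1))
      have hi : N - 1 - (k + 1) + 1 = N - 1 - k := by omega
      rw [hi] at hr
      change a k < 1 ∧ a k = a (k + 1) * ((1 - a k) ^ 2 * (1 + a k)) at hr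
      obtain ⟨hr1, hr2⟩ := hr
      have p0 := hap k
      have p1 := hap (k + 1)
      have q0 := hsp k
      have q1 := hlp (k + 1)
      have r0 := hbp k
      have r1 := hbp (k + 1)
      have key : l k = l (k + 1) * (1 + a (k + 1)) * (1 - a k) := by
        have hk1 : l (k + 1) * (1 + a (k + 1)) = b (k + 1) * s (k + 1) / σ ^ 2 := by
          rw [hl]
          field_simp
        have e0 := hb k
        have e1 := hb (k + 1)
        have e2 : s (k + 1) * (1 + a k) = s k := by
          rw [hss]; field_simp
        have q2 := hsp (k + 1)
        have hsq : l k ^ 2 = (l (k + 1) * (1 + a (k + 1)) * (1 - a k)) ^ 2 := by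
          rw [hk1, hl]
          have f0 : (b k * s k) ^ 2 = a k * σ ^ 2 * s k / Δ := by
            rw [← e0]; field_simp
          have f1 : (b (k + 1) * s (k + 1)) ^ 2 = a (k + 1) * σ ^ 2 * s (k + 1) / Δ := by
            rw [← e1]; field_simp
          rw [mul_pow, div_pow, div_pow, f0, f1, ← e2]
          have : a k * σ ^ 2 * (s (k + 1) * (1 + a k)) / Δ / (σ ^ 2 * (1 + a k)) ^ 2
              = a k / (1 + a k) * s (k + 1) / (Δ * σ ^ 2) := by
            field_simp
          rw [this]
          have h3 : a k / (1 + a k) = a (k + 1) * (1 - a k) ^ 2 := by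
            rw [div_eq_iff (by positivity)]
            linarith
          rw [h3]
          field_simp
        have hpos : 0 ≤ l (k + 1) * (1 + a (k + 1)) * (1 - a k) := by
          have : 0 < 1 - a k := by linarith
          positivity
        exact (pow_left_inj₀ (hlp k).le hpos two_ne_zero).1 hsq
      rw [key]
      field_simp
    · have : a k = 1 := by
        simp only [a]
        rw [show N - 1 - k = 0 by omega, hA0]
      rw [this]
      norm_num
  refine ⟨⟨WithLp.toLp 2 fun i => l i, fun i => s i,
    fun i => if (i : ℕ) < N then 1 / (2 * l i * (1 + a i)) else 0,
    WithLp.toLp 2 fun i => b i⟩, rfl, by simp, fun i => rfl, ?_, ?_, ?_, fun i => hbp i, ?_⟩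
  · intro i
    simp only [Fin.val_succ, Fin.val_castSucc]
    rw [hb, hss]
    have := hap i
    field_simp
    ring
  · intro i
    simp only [Fin.val_succ, Fin.val_castSucc]
    rw [hx i i.2, if_pos i.2]
    congr 1
    ring
  · intro i
    simp only [Fin.val_succ]
    rw [mul_assoc 2, hx i i.2, hl]
    have p := hap i
    have q := hsp i
    have r := hbp i
    have e0 := hb i
    rw [eq_div_iff]
    · have : b i * (Δ * 2 * (b i * s i / (σ ^ 2 * (1 + a i))) * (1 - (1 - a i) / 2))
          = (b i ^ 2 * s i * Δ) / σ ^ 2 := by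
        field_simp
        ring
      rw [this, e0]
      field_simp
      ring
    · have : 1 - (1 - a i) / 2 = (1 + a i) / 2 := by ring
      rw [this]
      positivity
  · intro i
    simp only [Fin.val_succ]
    rw [hx i i.2]
    have := hap i
    linarith

theorem IsKyleEquilibrium.Sig_pos {N : ℕ} {Δ σ S0 : ℝ} (hΔ : 0 < Δ) (hσ : 0 < σ) (hS : 0 < S0)
    {e : KyleCoeffs N} (h : IsKyleEquilibrium Δ σ S0 e) (i : Fin (N + 1)) : 0 < e.Sig i := by
  induction i using Fin.induction with
  | zero => rw [h.Sig_zero]; exact hS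
  | succ i ih =>
    rw [h.Sig_eq]
    positivity

theorem IsKyleEquilibrium.lam_pos {N : ℕ} {Δ σ S0 : ℝ} (hΔ : 0 < Δ) (hσ : 0 < σ) (hS : 0 < S0)
    {e : KyleCoeffs N} (h : IsKyleEquilibrium Δ σ S0 e) (i : Fin N) : 0 < e.lam i := by
  rw [h.lam_eq]
  have := h.Sig_pos hΔ hσ hS i.castSucc
  have := h.bet_pos i
  positivity

theorem IsKyleEquilibrium.alp_mul_lam {N : ℕ} {Δ σ S0 : ℝ} (hΔ : 0 < Δ) (hσ : 0 < σ)
    (hS : 0 < S0) {e : KyleCoeffs N} (h : IsKyleEquilibrium Δ σ S0 e) (i : Fin N) :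
    e.alp i.succ * e.lam i = (1 - e.bet i ^ 2 * e.Sig i.castSucc * Δ / σ ^ 2) / 2 := by
  have p := h.Sig_pos hΔ hσ hS i.castSucc
  have q := h.bet_pos i
  have r := h.lam_pos hΔ hσ hS i
  have hx := h.second_order i
  have h1 := h.bet_eq i
  have h2 := h.lam_eq i
  rw [mul_assoc 2] at h1
  set x := e.alp i.succ * e.lam i with hxdef
  have hx' : 0 < 1 - x := by linarith
  rw [eq_div_iff (by positivity)] at h1 h2
  have h3 : e.lam i * (e.bet i * Δ * (2 * (1 - x))) = 1 - 2 * x := by linarith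
  have h4 : e.bet i ^ 2 * e.Sig i.castSucc * Δ * (2 * (1 - x)) =
      (1 - 2 * x) * (e.bet i ^ 2 * e.Sig i.castSucc * Δ + σ ^ 2) := by
    rw [← h3]
    linear_combination (-(e.bet i * Δ * (2 * (1 - x)))) * h2
  field_simp
  linarith

theorem IsKyleEquilibrium.recursion {N : ℕ} {Δ σ S0 : ℝ} (hΔ : 0 < Δ) (hσ : 0 < σ)
    (hS : 0 < S0) {e : KyleCoeffs N} (h : IsKyleEquilibrium Δ σ S0 e) (i j : Fin N)
    (hij : i.succ = j.castSucc) {a a' : ℝ}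
    (ha : a = e.bet i ^ 2 * e.Sig i.castSucc * Δ / σ ^ 2)
    (ha' : a' = e.bet j ^ 2 * e.Sig j.castSucc * Δ / σ ^ 2) :
    0 < a ∧ a < 1 ∧ 0 < a' ∧ a = a' * ((1 - a) ^ 2 * (1 + a)) := by
  have p := h.Sig_pos hΔ hσ hS i.castSucc
  have p' := h.Sig_pos hΔ hσ hS j.castSucc
  have q := h.bet_pos i
  have q' := h.bet_pos j
  have r := h.lam_pos hΔ hσ hS i
  have r' := h.lam_pos hΔ hσ hS j
  have hx := h.alp_mul_lam hΔ hσ hS i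
  have hx' := h.alp_mul_lam hΔ hσ hS j
  rw [← ha] at hx
  rw [← ha'] at hx'
  have hal := h.alp_eq j
  rw [hx', ← hij] at hal
  have a0 : 0 < a := by rw [ha]; positivity
  have a0' : 0 < a' := by rw [ha']; positivity
  have hal' : e.alp i.succ = 1 / (2 * e.lam j * (1 + a')) := by
    rw [hal]; congr 1; ring
  have e0 : e.lam i = e.bet i * e.Sig i.castSucc / (σ ^ 2 * (1 + a)) := by
    rw [h.lam_eq, ha]; congr 1; field_simp; ring
  have e1 : e.lam j = e.bet j * e.Sig j.castSucc / (σ ^ 2 * (1 + a')) := by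
    rw [h.lam_eq, ha']; congr 1; field_simp; ring
  have e2 : e.Sig j.castSucc = e.Sig i.castSucc / (1 + a) := by
    rw [← hij, h.Sig_eq, ha]
    field_simp
    ring
  have key : e.lam i = e.lam j * (1 + a') * (1 - a) := by
    rw [hal'] at hx
    field_simp at hx
    linarith
  have a1 : a < 1 := by
    have h5 : 0 < e.lam j * (1 + a') * (1 - a) := key ▸ r
    have h6 := (pos_iff_pos_of_mul_pos h5).1 (by positivity)
    linarith
  refine ⟨a0, a1, a0', ?_⟩
  have f0 : (e.bet i * e.Sig i.castSucc) ^ 2 = a * σ ^ 2 * e.Sig i.castSucc / Δ := by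
    rw [ha]; field_simp
  have f1 : (e.bet j * e.Sig j.castSucc) ^ 2 = a' * σ ^ 2 * e.Sig j.castSucc / Δ := by
    rw [ha']; field_simp
  have hsq := congrArg (· ^ 2) key
  simp only [e0, e1] at hsq
  have h7 : e.bet j * e.Sig j.castSucc / (σ ^ 2 * (1 + a')) * (1 + a') * (1 - a)
      = e.bet j * e.Sig j.castSucc / σ ^ 2 * (1 - a) := by
    field_simp
  rw [h7, mul_pow, div_pow, div_pow, f0, f1, e2] at hsq
  field_simp at hsq
  linarith

theorem kyle_unique {N : ℕ} {Δ σ S0 : ℝ} (hΔ : 0 < Δ) (hσ : 0 < σ) (hS : 0 < S0)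
    {e e' : KyleCoeffs N} (h : IsKyleEquilibrium Δ σ S0 e) (h' : IsKyleEquilibrium Δ σ S0 e') :
    e = e' := by
  have hlast : ∀ (f : KyleCoeffs N), IsKyleEquilibrium Δ σ S0 f → ∀ i : Fin N,
      (i : ℕ) + 1 = N → f.bet i ^ 2 * f.Sig i.castSucc * Δ / σ ^ 2 = 1 := by
    intro f hf i hi
    have h1 := hf.alp_mul_lam hΔ hσ hS i
    have h2 : i.succ = Fin.last N := Fin.ext (by simpa using hi)
    rw [h2, hf.alp_last] at h1
    linarith
  have ha : ∀ k : ℕ, ∀ i : Fin N, (i : ℕ) + 1 + k = N →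
      e.bet i ^ 2 * e.Sig i.castSucc * Δ / σ ^ 2 =
        e'.bet i ^ 2 * e'.Sig i.castSucc * Δ / σ ^ 2 := by
    intro k
    induction k with
    | zero =>
      intro i hi
      rw [hlast e h i hi, hlast e' h' i hi]
    | succ k ih =>
      intro i hi
      have hj : (i : ℕ) + 1 < N := by omega
      have h1 := ih ⟨i + 1, hj⟩ (by simp only; omega)
      have hij : i.succ = (⟨i + 1, hj⟩ : Fin N).castSucc := Fin.ext (by simp)
      obtain ⟨p0, p1, p2, p3⟩ := h.recursion hΔ hσ hS i _ hij rfl rfl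
      obtain ⟨q0, q1, q2, q3⟩ := h'.recursion hΔ hσ hS i _ hij rfl rfl
      rw [← h1] at q3
      exact le_antisymm (kyle_root_le p2 q0 q3 p1 p3) (kyle_root_le p2 p0 p3 q1 q3)
  have ha' : ∀ i : Fin N, e.bet i ^ 2 * e.Sig i.castSucc * Δ =
      e'.bet i ^ 2 * e'.Sig i.castSucc * Δ := by
    intro i
    have h1 := ha (N - (i + 1)) i (by omega)
    exact (div_left_inj' (by positivity)).1 h1
  have hSig : ∀ i, e.Sig i = e'.Sig i := by
    intro i
    induction i using Fin.induction with
    | zero => rw [h.Sig_zero, h'.Sig_zero]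
    | succ i ih => rw [h.Sig_eq, h'.Sig_eq, ha', ih]
  have hbet : ∀ i, e.bet i = e'.bet i := by
    intro i
    have h1 := ha' i
    rw [hSig] at h1
    have h2 := h'.Sig_pos hΔ hσ hS i.castSucc
    have h3 := mul_right_cancel₀ h2.ne' (mul_right_cancel₀ hΔ.ne' h1)
    exact (pow_left_inj₀ (h.bet_pos i).le (h'.bet_pos i).le two_ne_zero).1 h3
  have hlam : ∀ i, e.lam i = e'.lam i := by
    intro i
    rw [h.lam_eq, h'.lam_eq, hSig, hbet]
  have halp : ∀ i, e.alp i = e'.alp i := by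
    intro i
    induction i using Fin.reverseInduction with
    | last => rw [h.alp_last, h'.alp_last]
    | cast i ih => rw [h.alp_eq, h'.alp_eq, ih, hlam]
  ext i
  · exact hlam i
  · exact hSig i
  · exact halp i
  · exact hbet i

theorem existsUnique_kyleEquilibrium (N : ℕ) {Δ σ S0 : ℝ} (hΔ : 0 < Δ) (hσ : 0 < σ)
    (hS : 0 < S0) : ∃! e : KyleCoeffs N, IsKyleEquilibrium Δ σ S0 e := by
  obtain ⟨e, he⟩ := kyle_exists N hΔ hσ hS
  exact ⟨e, he, fun e' he' => kyle_unique hΔ hσ hS he' he⟩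

/-- The unique equilibrium coefficients. -/
noncomputable def kyleEquilibrium (N : ℕ) {Δ σ S0 : ℝ} (hΔ : 0 < Δ) (hσ : 0 < σ)
    (hS : 0 < S0) : KyleCoeffs N :=
  (existsUnique_kyleEquilibrium N hΔ hσ hS).choose

theorem isKyleEquilibrium_kyleEquilibrium (N : ℕ) {Δ σ S0 : ℝ} (hΔ : 0 < Δ) (hσ : 0 < σ)
    (hS : 0 < S0) : IsKyleEquilibrium Δ σ S0 (kyleEquilibrium N hΔ hσ hS) :=
  (existsUnique_kyleEquilibrium N hΔ hσ hS).choose_spec.1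

/-- The backward recursion `α_N = 0`, `αₙ₋₁ = 1 / (4 λₙ (1 - αₙ λₙ))` for `n = N, …, 1`. -/
noncomputable def insiderAlpha {N : ℕ} (lam : EuclideanSpace ℝ (Fin N)) : Fin (N + 1) → ℝ :=
  fun j => Fin.reverseInduction (motive := fun _ => ℝ) 0
    (fun i a => 1 / (4 * lam i * (1 - a * lam i))) j

/-- The insider's response `β` to the pricing rule `λ`. -/
noncomputable def insiderResponse {N : ℕ} (Δ : ℝ) (lam : EuclideanSpace ℝ (Fin N)) :
    EuclideanSpace ℝ (Fin N) :=
  WithLp.toLp 2 fun i => (1 - 2 * insiderAlpha lam i.succ * lam i) /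
    (Δ * 2 * lam i * (1 - insiderAlpha lam i.succ * lam i))

/-- The forward recursion `Σₙ = Σₙ₋₁ σ² / (βₙ² Σₙ₋₁ Δ + σ²)` for `n = 1, …, N`, started at `S0`. -/
noncomputable def marketSigma {N : ℕ} (Δ σ S0 : ℝ) (bet : EuclideanSpace ℝ (Fin N)) :
    Fin (N + 1) → ℝ :=
  fun j => Fin.induction (motive := fun _ => ℝ) S0
    (fun i s => s * σ ^ 2 / (bet i ^ 2 * s * Δ + σ ^ 2)) j

/-- The market makers' response `λ` to the trading intensities `β`. -/
noncomputable def marketResponse {N : ℕ} (Δ σ S0 : ℝ) (bet : EuclideanSpace ℝ (Fin N)) :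
    EuclideanSpace ℝ (Fin N) :=
  WithLp.toLp 2 fun i => bet i * marketSigma Δ σ S0 bet i.castSucc /
    (bet i ^ 2 * marketSigma Δ σ S0 bet i.castSucc * Δ + σ ^ 2)

/-- The policy iteration map `S` of the market makers, to be used on `policyDomain` only. -/
noncomputable def policyMap {N : ℕ} (Δ σ S0 : ℝ) (lam : EuclideanSpace ℝ (Fin N)) :
    EuclideanSpace ℝ (Fin N) :=
  marketResponse Δ σ S0 (insiderResponse Δ lam)

/-- The domain of `S`: the pricing rules for which no division by zero occurs in the recursions. (The
denominators in the forward recursion are positive when `Δ, σ, S0` are.) -/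
def policyDomain (N : ℕ) : Set (EuclideanSpace ℝ (Fin N)) :=
  {lam | ∀ i : Fin N, lam i ≠ 0 ∧ 1 - insiderAlpha lam i.succ * lam i ≠ 0}

/-- The policy iterations of a partial map, given by `f` on `D`, with starting policy `x` converge
to `y`. Outside `D` the map takes the value `∞`, and the iteration stays there, so that all iterates
of a convergent sequence lie in `D`. -/
def IterationConverges {N : ℕ} (D : Set (EuclideanSpace ℝ (Fin N)))
    (f : EuclideanSpace ℝ (Fin N) → EuclideanSpace ℝ (Fin N)) (x y : EuclideanSpace ℝ (Fin N)) :
    Prop :=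
  (∀ m : ℕ, f^[m] x ∈ D) ∧ Filter.Tendsto (fun m : ℕ => f^[m] x) Filter.atTop (nhds y)

/-- `y` is locally stable: all starting policies in the domain and near `y` lead to convergence. -/
def IsLocallyStable {N : ℕ} (D : Set (EuclideanSpace ℝ (Fin N)))
    (f : EuclideanSpace ℝ (Fin N) → EuclideanSpace ℝ (Fin N)) (y : EuclideanSpace ℝ (Fin N)) :
    Prop :=
  ∃ ε : ℝ, 0 < ε ∧ ∀ x ∈ D, 0 < ‖x - y‖ → ‖x - y‖ < ε → IterationConverges D f x y

/-- The fixed point `y` is unstable: `y` is the only starting policy that leads to convergence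
to `y`. -/
def IsUnstable {N : ℕ} (D : Set (EuclideanSpace ℝ (Fin N)))
    (f : EuclideanSpace ℝ (Fin N) → EuclideanSpace ℝ (Fin N)) (y : EuclideanSpace ℝ (Fin N)) :
    Prop :=
  ∀ x, IterationConverges D f x y → x = y

/-! ### Fixed points whose derivative factors through a smaller space. -/

section AbstractDynamics

variable {E F : Type*} [NormedAddCommGroup E] [NormedSpace ℝ E] [NormedAddCommGroup F]
  [NormedSpace ℝ F]

/-! Write `aₙ = βₙ² Σₙ₋₁ Δ / σ²` at the equilibrium. There `a_N = 1`, which makes `λ_N` critical as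
a function of `β_N`. The derivative of the policy map therefore factors as `C ∘ P` through
`ℝ^(N-1)`, and `P ∘ C` carries its nonzero spectrum. In relative variations `P ∘ C` depends on the
`aₙ` alone, and these obey a recursion free of `Δ`, `σ` and `Σ₀`.

For `N = 1` the intermediate space is trivial, and for `N = 2` the operator `P ∘ C` is a scalar of
modulus below one (`IsLinearizedIteration.exists_lt_one`). An adapted norm then gives convergence
(`exists_ball_iterate_tendsto`).

For `N ≥ 3` the determinant of `P ∘ C` exceeds one in modulus
(`IsLinearizedIteration.prod_le_abs_det`, `IsKyleSequence.one_lt_prod`). Orbits leaving a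
neighbourhood do not by themselves refute convergence, since they might return and converge. Two
facts close this gap. Near the equilibrium, discs along the range of `C` have `P`-projections of
growing volume, so no open set has all its orbits confined there. And the policy map sends nonempty
open sets of its domain to sets with interior. If all nearby policies converged, Baire's theorem
would give an open set whose orbits are confined from a common time on, and its image at that time
would contain a forbidden open set.

Global instability fails because `β₁`, as a function of `λ₁`, takes its equilibrium value at a
second point; that policy reaches the equilibrium in one step. -/

/-- If the derivative of `f` at a fixed point `y` factors as `C ∘ P` and `P ∘ C` is a contraction,
then the orbits that start near `y` stay near `y` and converge to `y`. -/
theorem exists_ball_iterate_tendsto {f : E → E} {y : E} {P : E →L[ℝ] F} {C : F →L[ℝ] E}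
    (hy : f y = y) (hf : HasFDerivAt f (C ∘L P) y) (hPC : ‖P ∘L C‖ < 1)
    {D : Set E} (hD : D ∈ nhds y) :
    ∃ ε > 0, ∀ x, ‖x - y‖ < ε → (∀ m : ℕ, f^[m] x ∈ D) ∧
      Filter.Tendsto (fun m : ℕ => f^[m] x) Filter.atTop (nhds y) := by
  set b := ‖P ∘L C‖ with hb
  have hb0 : 0 ≤ b := norm_nonneg _
  set ρ := (1 + b) / 2 with hρ
  have hρ1 : ρ < 1 := by rw [hρ]; linarith
  have hρ0 : 0 < ρ := by rw [hρ]; linarith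
  -- Weight of the adapted norm `φ z = ‖P z‖ + θ ‖z‖`: small enough that the feedback `θ ‖C‖` uses
  -- at most half of the gap `1 - b`.
  set θ := (1 - b) / (2 * (‖C‖ + 1)) with hθ
  have hC0 := norm_nonneg C
  have hP0 := norm_nonneg P
  have hθ0 : 0 < θ := div_pos (by linarith) (by linarith)
  have hθC : b + θ * ‖C‖ ≤ ρ := by
    have : θ * (‖C‖ + 1) = (1 - b) / 2 := by rw [hθ]; field_simp
    rw [hρ]; nlinarith
  -- With this tolerance the nonlinear error, measured by `φ`, is absorbed by the term `ρ θ ‖z‖` of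
  -- `ρ φ z`.
  set η := ρ * θ / (‖P‖ + θ) with hη
  have hη0 : 0 < η := by positivity
  have hηle : (‖P‖ + θ) * η = ρ * θ := by rw [hη]; field_simp
  let φ : E → ℝ := fun z => ‖P z‖ + θ * ‖z‖
  have hφ1 : ∀ z, θ * ‖z‖ ≤ φ z := fun z => by
    have := norm_nonneg (P z); simp only [φ]; linarith
  have hφ2 : ∀ z, φ z ≤ (‖P‖ + θ) * ‖z‖ := fun z => by
    have := P.le_opNorm z; simp only [φ]; linarith
  have hlo := hf.isLittleO.def hη0
  obtain ⟨r, hr0, hr⟩ := Metric.eventually_nhds_iff_ball.1 (hlo.and hD)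
  have step : ∀ x, ‖x - y‖ < r → φ (f x - y) ≤ ρ * φ (x - y) := by
    intro x hx
    have h1 := (hr x (by simpa [dist_eq_norm] using hx)).1
    rw [hy] at h1
    set z := x - y with hz
    set e := f x - y - (C ∘L P) z with he
    have h2 : f x - y = C (P z) + e := by simp [he]
    have h3 : ‖P (f x - y)‖ ≤ b * ‖P z‖ + ‖P‖ * ‖e‖ := by
      rw [h2, map_add]
      exact (norm_add_le _ _).trans (add_le_add ((P ∘L C).le_opNorm (P z)) (P.le_opNorm e))
    have h4 : ‖f x - y‖ ≤ ‖C‖ * ‖P z‖ + ‖e‖ := by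
      rw [h2]
      exact (norm_add_le _ _).trans (add_le_add (C.le_opNorm (P z)) le_rfl)
    have h5 := norm_nonneg (P z)
    calc φ (f x - y) ≤ (b * ‖P z‖ + ‖P‖ * ‖e‖) + θ * (‖C‖ * ‖P z‖ + ‖e‖) :=
          add_le_add h3 (mul_le_mul_of_nonneg_left h4 hθ0.le)
      _ = (b + θ * ‖C‖) * ‖P z‖ + (‖P‖ + θ) * ‖e‖ := by ring
      _ ≤ ρ * ‖P z‖ + (‖P‖ + θ) * (η * ‖z‖) := by gcongr
      _ = ρ * φ z := by rw [← mul_assoc, hηle]; simp only [φ]; ring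
  refine ⟨r * θ / (‖P‖ + θ), by positivity, fun x hx => ?_⟩
  have hx' : φ (x - y) < r * θ := by
    refine (hφ2 _).trans_lt ?_
    rw [lt_div_iff₀ (by positivity)] at hx
    linarith
  have hφ0 : 0 ≤ φ (x - y) := (by positivity : (0 : ℝ) ≤ θ * ‖x - y‖).trans (hφ1 _)
  have main : ∀ m : ℕ, φ (f^[m] x - y) ≤ ρ ^ m * φ (x - y) ∧ ‖f^[m] x - y‖ < r := by
    have small : ∀ m : ℕ, φ (f^[m] x - y) ≤ ρ ^ m * φ (x - y) → ‖f^[m] x - y‖ < r := by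
      intro m hm
      have h1 : ρ ^ m * φ (x - y) ≤ φ (x - y) :=
        mul_le_of_le_one_left hφ0 (pow_le_one₀ hρ0.le hρ1.le)
      have h2 := hφ1 (f^[m] x - y)
      have h3 : θ * ‖f^[m] x - y‖ < θ * r := by linarith
      exact lt_of_mul_lt_mul_left h3 hθ0.le
    intro m
    induction m with
    | zero => exact ⟨by simp, small 0 (by simp)⟩
    | succ m ih =>
      have h : φ (f^[m + 1] x - y) ≤ ρ ^ (m + 1) * φ (x - y) := by
        rw [Function.iterate_succ_apply', pow_succ']
        refine (step _ ih.2).trans ?_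
        rw [mul_assoc]
        exact mul_le_mul_of_nonneg_left ih.1 hρ0.le
      exact ⟨h, small _ h⟩
  refine ⟨fun m => (hr _ (by simpa [dist_eq_norm] using (main m).2)).2, ?_⟩
  rw [tendsto_iff_norm_sub_tendsto_zero]
  refine squeeze_zero (fun m => norm_nonneg _) (g := fun m => ρ ^ m * (φ (x - y) / θ)) ?_ ?_
  · intro m
    have h1 := (hφ1 (f^[m] x - y)).trans (main m).1
    rw [← mul_div_assoc, le_div_iff₀ hθ0]
    linarith
  · simpa using (tendsto_pow_atTop_nhds_zero_of_lt_one hρ0.le hρ1).mul_const (φ (x - y) / θ)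

open MeasureTheory in
/-- If the strict derivative of `f` at `y` factors as `C ∘ P` through a finite-dimensional space and
`P ∘ C` increases volumes, then no nonempty open set has all its orbits near `y`. -/
theorem exists_closedBall_forall_isOpen_exists_iterate_notMem [FiniteDimensional ℝ F]
    {f : E → E} {y : E} {P : E →L[ℝ] F} {C : F →L[ℝ] E}
    (hf : HasStrictFDerivAt f (C ∘L P) y) (hdet : 1 < |(P ∘L C).det|) :
    ∃ δ > 0, ∀ O : Set E, IsOpen O → O.Nonempty →
      ∃ x ∈ O, ∃ m : ℕ, f^[m] x ∉ Metric.closedBall y δ := by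
  borelize F
  let μ : Measure F := Measure.addHaar
  set B : F →L[ℝ] F := P ∘L C with hB
  have hB0 : B.det ≠ 0 := fun h => by rw [h] at hdet; simp at hdet; linarith
  obtain ⟨c, hc1, hc⟩ : ∃ c : NNReal, 1 < c ∧ (c : ENNReal) < ENNReal.ofReal |B.det| := by
    have h1 : (1 : ENNReal) < ENNReal.ofReal |B.det| := by simpa using hdet
    obtain ⟨c, h2, h3⟩ := ENNReal.lt_iff_exists_nnreal_btwn.1 h1
    exact ⟨c, by exact_mod_cast h2, h3⟩
  obtain ⟨ζ, hvol, hζ0⟩ := ((mul_le_addHaar_image_of_lt_det μ B hc).and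
    self_mem_nhdsWithin).exists
  change (0 : NNReal) < ζ at hζ0
  let Be : F ≃L[ℝ] F := B.toContinuousLinearEquivOfDetNeZero hB0
  have hBe : ∀ v, Be v = B v := fun v => rfl
  obtain ⟨κ, hκ0, hκ⟩ : ∃ κ : ℝ, 0 < κ ∧ ∀ v, κ * ‖v‖ ≤ ‖B v‖ := by
    refine ⟨(‖(Be.symm : F →L[ℝ] F)‖ + 1)⁻¹, by positivity, fun v => ?_⟩
    rw [inv_mul_le_iff₀ (by positivity)]
    have h1 : ‖Be.symm (Be v)‖ ≤ ‖(Be.symm : F →L[ℝ] F)‖ * ‖Be v‖ :=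
      (Be.symm : F →L[ℝ] F).le_opNorm (Be v)
    rw [Be.symm_apply_apply, hBe] at h1
    nlinarith [norm_nonneg (B v)]
  have hC0 := norm_nonneg C
  have hP0 := norm_nonneg P
  set K := 2 * (‖C‖ + 1) / κ with hK
  have hK0 : 0 < K := by positivity
  have hKκ : K * (κ / 2) = ‖C‖ + 1 := by rw [hK]; field_simp
  -- The first two bounds on the linearization error keep differences in the cone `‖z‖ ≤ K ‖P z‖`;
  -- the third makes the projected dynamics close enough to `B` for the volume estimate.
  obtain ⟨η, hη0, hη1, hη2, hη3⟩ : ∃ η : ℝ, 0 < η ∧ η * K ≤ 1 ∧ ‖P‖ * (η * K) ≤ κ / 2 ∧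
      ‖P‖ * (η * K) ≤ ζ := by
    have hζ0' : (0 : ℝ) < ζ := by exact_mod_cast hζ0
    set t := min 1 (min (κ / 2) ζ / (‖P‖ + 1)) with ht
    have ht0 : 0 < t := by positivity
    have ht1 : ‖P‖ * t ≤ min (κ / 2) ζ := by
      have h1 : t ≤ min (κ / 2) ζ / (‖P‖ + 1) := min_le_right _ _
      rw [le_div_iff₀ (by positivity)] at h1
      nlinarith
    have h2 : t / K * K = t := by field_simp
    refine ⟨t / K, by positivity, ?_, ?_, ?_⟩ <;> rw [h2]
    · exact min_le_left _ _
    · exact ht1.trans (min_le_left _ _)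
    · exact ht1.trans (min_le_right _ _)
  obtain ⟨s, hs, happ⟩ := hf.approximates_deriv_on_nhds (c := ⟨η, hη0.le⟩) (Or.inr hη0)
  obtain ⟨δ, hδ0, hδ⟩ := Metric.nhds_basis_closedBall.mem_iff.1 hs
  refine ⟨δ, hδ0, fun O hO hOne => ?_⟩
  by_contra! hcon
  obtain ⟨x₀, hx₀⟩ := hOne
  obtain ⟨r, hr0, hr⟩ := Metric.isOpen_iff.1 (hO.preimage
    (show Continuous fun v : F => x₀ + C v by fun_prop)) 0 (by simpa using hx₀)
  -- Iterates of a disc parallel to the range of `C`. Only their projections under `P` are measured,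
  -- so directions collapsed by `f` do no harm.
  let Γ : ℕ → Set E := fun m => f^[m] '' ((fun v : F => x₀ + C v) '' Metric.ball 0 r)
  have hΓsucc : ∀ m, Γ (m + 1) = f '' Γ m := fun m => by
    simp only [Γ, Function.iterate_succ', Set.image_comp]
  have hΓδ : ∀ m, Γ m ⊆ Metric.closedBall y δ := by
    rintro m _ ⟨_, ⟨v, hv, rfl⟩, rfl⟩
    exact hcon _ (hr hv) m
  have err : ∀ m, ∀ x ∈ Γ m, ∀ x' ∈ Γ m,
      ‖f x - f x' - C (P (x - x'))‖ ≤ η * ‖x - x'‖ := fun m x hx x' hx' =>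
    happ x (hδ (hΓδ m hx)) x' (hδ (hΓδ m hx'))
  have cone : ∀ m, ∀ x ∈ Γ m, ∀ x' ∈ Γ m, ‖x - x'‖ ≤ K * ‖P (x - x')‖ := by
    intro m
    induction m with
    | zero =>
      rintro _ ⟨_, ⟨v, hv, rfl⟩, rfl⟩ _ ⟨_, ⟨v', hv', rfl⟩, rfl⟩
      have h1 : x₀ + C v - (x₀ + C v') = C (v - v') := by rw [map_sub]; abel
      simp only [Function.iterate_zero, id_eq, h1]
      have h2 : κ * ‖v - v'‖ ≤ ‖P (C (v - v'))‖ := hκ (v - v')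
      have h3 := C.le_opNorm (v - v')
      have h4 := norm_nonneg (v - v')
      have h5 : K * (κ * ‖v - v'‖) ≤ K * ‖P (C (v - v'))‖ := by gcongr
      have h6 : K * (κ * ‖v - v'‖) = 2 * (‖C‖ + 1) * ‖v - v'‖ := by
        rw [hK]; field_simp
      nlinarith
    | succ m ih =>
      rw [hΓsucc]
      rintro _ ⟨x, hx, rfl⟩ _ ⟨x', hx', rfl⟩
      have h1 := err m x hx x' hx'
      have h2 := ih x hx x' hx'
      set z := x - x'
      set e := f x - f x' - C (P z) with he
      have h3 : f x - f x' = C (P z) + e := by simp [he]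
      have h4 : ‖e‖ ≤ η * K * ‖P z‖ := by
        rw [mul_assoc]; exact h1.trans (by gcongr)
      have h0 := norm_nonneg (P z)
      have h5 : ‖f x - f x'‖ ≤ (‖C‖ + 1) * ‖P z‖ := by
        rw [h3]
        have := norm_add_le (C (P z)) e
        have := C.le_opNorm (P z)
        nlinarith
      have h6 : κ / 2 * ‖P z‖ ≤ ‖P (f x - f x')‖ := by
        rw [h3, map_add]
        have h7 : κ * ‖P z‖ ≤ ‖P (C (P z))‖ := hκ (P z)
        have h8 : ‖P e‖ ≤ κ / 2 * ‖P z‖ := by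
          calc ‖P e‖ ≤ ‖P‖ * ‖e‖ := P.le_opNorm e
            _ ≤ ‖P‖ * (η * K * ‖P z‖) := by gcongr
            _ = ‖P‖ * (η * K) * ‖P z‖ := by ring
            _ ≤ κ / 2 * ‖P z‖ := by gcongr
        have h9 := norm_sub_le (P (C (P z)) + P e) (P e)
        rw [add_sub_cancel_right] at h9
        linarith
      calc ‖f x - f x'‖ ≤ (‖C‖ + 1) * ‖P z‖ := h5
        _ = K * (κ / 2 * ‖P z‖) := by rw [← hKκ]; ring
        _ ≤ K * ‖P (f x - f x')‖ := by gcongr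
  have grow : ∀ m, (c : ENNReal) * μ (P '' Γ m) ≤ μ (P '' Γ (m + 1)) := by
    intro m
    have hinj : ∀ x ∈ Γ m, ∀ x' ∈ Γ m, P x = P x' → x = x' := by
      intro x hx x' hx' h
      have h1 := cone m x hx x' hx'
      rw [map_sub, h, sub_self, norm_zero, mul_zero] at h1
      exact sub_eq_zero.1 (norm_le_zero_iff.1 h1)
    -- By the cone condition `P` is injective on `Γ m`, so `f` induces a self-contained map `v ↦ P
    -- (f (σ v))` on projections, which is approximated by `B`.
    choose! σ hσ hPσ using fun (v : F) (hv : v ∈ P '' Γ m) => hv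
    have h1 : P '' Γ (m + 1) = (fun v => P (f (σ v))) '' (P '' Γ m) := by
      rw [hΓsucc]
      ext w
      constructor
      · rintro ⟨_, ⟨x, hx, rfl⟩, rfl⟩
        have hv := Set.mem_image_of_mem P hx
        refine ⟨P x, hv, ?_⟩
        simp only [hinj _ (hσ _ hv) x hx (hPσ _ hv)]
      · rintro ⟨v, hv, rfl⟩
        exact ⟨_, ⟨_, hσ v hv, rfl⟩, rfl⟩
    rw [h1]
    apply hvol
    intro v hv v' hv'
    have h2 := err m _ (hσ v hv) _ (hσ v' hv')
    have h3 := cone m _ (hσ v hv) _ (hσ v' hv')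
    rw [map_sub, hPσ v hv, hPσ v' hv'] at h3 h2
    have h4 : P (f (σ v)) - P (f (σ v')) - B (v - v') =
        P (f (σ v) - f (σ v') - C (v - v')) := by
      simp [hB]
    rw [h4]
    calc ‖P (f (σ v) - f (σ v') - C (v - v'))‖
        ≤ ‖P‖ * ‖f (σ v) - f (σ v') - C (v - v')‖ := P.le_opNorm _
      _ ≤ ‖P‖ * (η * (K * ‖v - v'‖)) := by
        gcongr; exact h2.trans (by gcongr)
      _ = ‖P‖ * (η * K) * ‖v - v'‖ := by ring
      _ ≤ ζ * ‖v - v'‖ := by gcongr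
  have hpow : ∀ m : ℕ, (c : ENNReal) ^ m * μ (P '' Γ 0) ≤ μ (P '' Γ m) := by
    intro m
    induction m with
    | zero => simp
    | succ m ih =>
      rw [pow_succ', mul_assoc]
      exact (mul_le_mul_right ih _).trans (grow m)
  have hpos : 0 < μ (P '' Γ 0) := by
    -- The initial projection is a translate of the image of a ball under the invertible `B`, hence
    -- open.
    have h1 : P '' Γ 0 = (fun v => P x₀ + Be v) '' Metric.ball 0 r := by
      simp only [Γ, Function.iterate_zero, Set.image_image, id_eq, map_add]
      rfl
    rw [h1]
    have h2 : IsOpenMap fun v => P x₀ + Be v :=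
      (Homeomorph.addLeft (P x₀)).isOpenMap.comp Be.toHomeomorph.isOpenMap
    exact (h2 _ Metric.isOpen_ball).measure_pos μ ((Metric.nonempty_ball.2 hr0).image _)
  have hbdd : ∀ m, μ (P '' Γ m) ≤ μ (Metric.closedBall (P y) (‖P‖ * δ)) := by
    intro m
    apply measure_mono
    rintro _ ⟨x, hx, rfl⟩
    have h1 := hΓδ m hx
    rw [mem_closedBall_iff_norm] at h1 ⊢
    rw [← map_sub]
    exact (P.le_opNorm _).trans (by gcongr)
  have hfin : μ (Metric.closedBall (P y) (‖P‖ * δ)) < ⊤ :=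
    (isCompact_closedBall _ _).measure_lt_top
  have htop : Filter.Tendsto (fun m : ℕ => (c : ENNReal) ^ m * μ (P '' Γ 0)) Filter.atTop
      (nhds ⊤) := by
    have h1 := ENNReal.tendsto_pow_atTop_nhds_top_iff.2 (show (1 : ENNReal) < c by exact_mod_cast hc1)
    have h2 := ENNReal.Tendsto.mul_const (b := μ (P '' Γ 0)) h1 (Or.inl ENNReal.top_ne_zero)
    rwa [ENNReal.top_mul hpos.ne'] at h2
  have := le_of_tendsto' htop fun m => (hpow m).trans (hbdd m)
  exact absurd hfin (not_lt.2 this)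

end AbstractDynamics

/-! ### Criteria for and against local stability. -/

theorem isLocallyStable_of_norm_lt_one {N : ℕ} {F : Type*} [NormedAddCommGroup F] [NormedSpace ℝ F]
    {D : Set (EuclideanSpace ℝ (Fin N))}
    {f : EuclideanSpace ℝ (Fin N) → EuclideanSpace ℝ (Fin N)} {y : EuclideanSpace ℝ (Fin N)}
    {P : EuclideanSpace ℝ (Fin N) →L[ℝ] F} {C : F →L[ℝ] EuclideanSpace ℝ (Fin N)}
    (hD : D ∈ nhds y) (hy : f y = y) (hf : HasFDerivAt f (C ∘L P) y) (hPC : ‖P ∘L C‖ < 1) :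
    IsLocallyStable D f y := by
  obtain ⟨ε, hε, h⟩ := exists_ball_iterate_tendsto hy hf hPC hD
  exact ⟨ε, hε, fun x _ _ hx => h x hx⟩

/-- Baire's theorem turns pointwise convergence into a common entry time on an open set. The
hypothesis `hopen` carries that set forward to this time, where volume growth forbids its orbits to
stay near `y`. -/
theorem not_isLocallyStable_of_one_lt_det {N : ℕ} {F : Type*} [NormedAddCommGroup F]
    [NormedSpace ℝ F] [FiniteDimensional ℝ F] {D : Set (EuclideanSpace ℝ (Fin N))}
    {f : EuclideanSpace ℝ (Fin N) → EuclideanSpace ℝ (Fin N)} {y : EuclideanSpace ℝ (Fin N)}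
    {P : EuclideanSpace ℝ (Fin N) →L[ℝ] F} {C : F →L[ℝ] EuclideanSpace ℝ (Fin N)}
    (hD : D ∈ nhds y) (hy : f y = y) (hcont : ContinuousOn f D)
    (hopen : ∀ O ⊆ D, IsOpen O → O.Nonempty → (interior (f '' O)).Nonempty)
    (hf : HasStrictFDerivAt f (C ∘L P) y) (hdet : 1 < |(P ∘L C).det|) :
    ¬ IsLocallyStable D f y := by
  rintro ⟨ε, hε, hst⟩
  obtain ⟨δ, hδ0, hδ⟩ := exists_closedBall_forall_isOpen_exists_iterate_notMem hf hdet
  obtain ⟨r, hr0, hr⟩ := Metric.nhds_basis_closedBall.mem_iff.1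
    (Filter.inter_mem hD (Metric.ball_mem_nhds y hε))
  have hyD : y ∈ D := (hr (Metric.mem_closedBall_self hr0.le)).1
  have conv : ∀ x ∈ Metric.closedBall y r, IterationConverges D f x y := by
    intro x hx
    rcases eq_or_ne x y with rfl | hne
    · have h1 : ∀ m : ℕ, f^[m] x = x := fun m => Function.iterate_fixed hy m
      exact ⟨fun m => by rwa [h1], by simp only [h1]; exact tendsto_const_nhds⟩
    · refine hst x (hr hx).1 (norm_pos_iff.2 (sub_ne_zero.2 hne)) ?_
      simpa [dist_eq_norm] using (hr hx).2
  have hcm : ∀ m : ℕ, ContinuousOn f^[m] (Metric.closedBall y r) := by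
    intro m
    induction m with
    | zero => exact continuousOn_id
    | succ m ih =>
      rw [Function.iterate_succ']
      exact hcont.comp ih fun x hx => (conv x hx).1 m
  let G : ℕ → Set (EuclideanSpace ℝ (Fin N)) := fun m =>
    ⋂ j : ℕ, Metric.closedBall y r ∩ f^[m + j] ⁻¹' Metric.closedBall y δ
  have hG : ∀ m, IsClosed (G m) := fun m => isClosed_iInter fun j =>
    (hcm _).preimage_isClosed_of_isClosed Metric.isClosed_closedBall Metric.isClosed_closedBall
  -- Adjoining the complement of the ball makes the closed sets cover the whole space, as Baire's
  -- theorem requires.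
  have hU : ⋃ m, (G m ∪ (Metric.ball y r)ᶜ) = Set.univ := by
    refine Set.eq_univ_of_forall fun x => Set.mem_iUnion.2 ?_
    by_cases hx : x ∈ Metric.ball y r
    · have hx' := Metric.ball_subset_closedBall hx
      obtain ⟨m, hm⟩ := Filter.eventually_atTop.1
        ((conv x hx').2.eventually (Metric.closedBall_mem_nhds y hδ0))
      exact ⟨m, Or.inl (Set.mem_iInter.2 fun j => ⟨hx', hm _ (Nat.le_add_right m j)⟩)⟩
    · exact ⟨0, Or.inr hx⟩
  have hdense := dense_iUnion_interior_of_closed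
    (fun m => (hG m).union Metric.isOpen_ball.isClosed_compl) hU
  obtain ⟨x, hx, hx'⟩ := hdense.exists_mem_open Metric.isOpen_ball (Metric.nonempty_ball.2 hr0)
  obtain ⟨m, hm⟩ := Set.mem_iUnion.1 hx
  set O := interior (G m ∪ (Metric.ball y r)ᶜ) ∩ Metric.ball y r with hOdef
  have hO : IsOpen O := isOpen_interior.inter Metric.isOpen_ball
  have hOne : O.Nonempty := ⟨x, hm, hx'⟩
  have hOG : O ⊆ G m := fun z hz => (interior_subset hz.1).resolve_right fun h => h hz.2
  have push : ∀ k : ℕ, ∃ V, IsOpen V ∧ V.Nonempty ∧ V ⊆ f^[k] '' O := by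
    intro k
    induction k with
    | zero => exact ⟨O, hO, hOne, by simp⟩
    | succ k ih =>
      obtain ⟨V, hV, hVne, hVO⟩ := ih
      have hVD : V ⊆ D := by
        intro v hv
        obtain ⟨z, hz, rfl⟩ := hVO hv
        exact (conv z (Metric.ball_subset_closedBall hz.2)).1 k
      refine ⟨_, isOpen_interior, hopen V hVD hV hVne, interior_subset.trans ?_⟩
      rw [Function.iterate_succ', Set.image_comp]
      exact Set.image_mono hVO
  obtain ⟨V, hV, hVne, hVO⟩ := push m
  obtain ⟨v, hv, j, hj⟩ := hδ V hV hVne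
  obtain ⟨z, hz, rfl⟩ := hVO hv
  apply hj
  rw [← Function.iterate_add_apply, add_comm]
  exact (Set.mem_iInter.1 (hOG hz) j).2

/-! ### Differentiability and openness of the two responses. -/

section Responses

variable {N : ℕ}

theorem HasStrictFDerivAt.fun_real_div {E : Type*} [NormedAddCommGroup E] [NormedSpace ℝ E]
    {c d : E → ℝ} {c' d' : E →L[ℝ] ℝ} {x : E} (hc : HasStrictFDerivAt c c' x)
    (hd : HasStrictFDerivAt d d' x) (hx : d x ≠ 0) :
    HasStrictFDerivAt (fun z => c z / d z) ((d x ^ 2)⁻¹ • (d x • c' - c x • d')) x := by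
  have h := hc.mul ((hasStrictDerivAt_inv hx).comp_hasStrictFDerivAt x hd)
  have e : (c * (Inv.inv ∘ d)) = fun z => c z / d z := by
    ext z; simp [div_eq_mul_inv]
  rw [e] at h
  convert! h using 1
  ext v
  simp
  field_simp
  ring

theorem EuclideanSpace.hasStrictFDerivAt_coord (i : Fin N) (x : EuclideanSpace ℝ (Fin N)) :
    HasStrictFDerivAt (fun z : EuclideanSpace ℝ (Fin N) => z i)
      (EuclideanSpace.proj i : EuclideanSpace ℝ (Fin N) →L[ℝ] ℝ) x :=
  (EuclideanSpace.proj (𝕜 := ℝ) i).hasStrictFDerivAt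

/-- A map into Euclidean space is strictly differentiable when its coordinates are. -/
theorem exists_hasStrictFDerivAt_of_coord {f : EuclideanSpace ℝ (Fin N) → EuclideanSpace ℝ (Fin N)}
    {x : EuclideanSpace ℝ (Fin N)} {f' : Fin N → EuclideanSpace ℝ (Fin N) →L[ℝ] ℝ}
    (h : ∀ i, HasStrictFDerivAt (fun z => f z i) (f' i) x) :
    ∃ L : EuclideanSpace ℝ (Fin N) →L[ℝ] EuclideanSpace ℝ (Fin N),
      HasStrictFDerivAt f L x ∧ ∀ v i, L v i = f' i v := by
  refine ⟨((EuclideanSpace.equiv (Fin N) ℝ).symm : (Fin N → ℝ) →L[ℝ] _) ∘L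
    ContinuousLinearMap.pi f', ?_, fun v i => rfl⟩
  rw [hasStrictFDerivAt_euclidean]
  exact h

@[simp]
theorem insiderAlpha_last (l : EuclideanSpace ℝ (Fin N)) : insiderAlpha l (Fin.last N) = 0 := by
  simp [insiderAlpha]

theorem insiderAlpha_castSucc (l : EuclideanSpace ℝ (Fin N)) (i : Fin N) :
    insiderAlpha l i.castSucc = 1 / (4 * l i * (1 - insiderAlpha l i.succ * l i)) := by
  simp [insiderAlpha]

@[simp]
theorem marketSigma_zero (Δ σ S0 : ℝ) (b : EuclideanSpace ℝ (Fin N)) :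
    marketSigma Δ σ S0 b 0 = S0 := by
  simp [marketSigma]

theorem marketSigma_succ (Δ σ S0 : ℝ) (b : EuclideanSpace ℝ (Fin N)) (i : Fin N) :
    marketSigma Δ σ S0 b i.succ = marketSigma Δ σ S0 b i.castSucc * σ ^ 2 /
      (b i ^ 2 * marketSigma Δ σ S0 b i.castSucc * Δ + σ ^ 2) := by
  simp [marketSigma]

theorem marketSigma_pos {Δ σ S0 : ℝ} (hΔ : 0 < Δ) (hσ : 0 < σ) (hS : 0 < S0)
    (b : EuclideanSpace ℝ (Fin N)) (j : Fin (N + 1)) : 0 < marketSigma Δ σ S0 b j := by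
  induction j using Fin.induction with
  | zero => simpa
  | succ i ih => rw [marketSigma_succ]; positivity

/-- The derivative of the insider's response, described by the linearized backward recursion. -/
theorem exists_hasStrictFDerivAt_insiderResponse {Δ : ℝ} (hΔ : 0 < Δ)
    {l : EuclideanSpace ℝ (Fin N)} (hl : l ∈ policyDomain N) :
    ∃ (A : Fin (N + 1) → EuclideanSpace ℝ (Fin N) →L[ℝ] ℝ)
      (U : EuclideanSpace ℝ (Fin N) →L[ℝ] EuclideanSpace ℝ (Fin N)),
      HasStrictFDerivAt (insiderResponse Δ) U l ∧
      (∀ j, HasStrictFDerivAt (fun z => insiderAlpha z j) (A j) l) ∧ A (Fin.last N) = 0 ∧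
      (∀ i v, A i.castSucc v =
        -((1 - 2 * (insiderAlpha l i.succ * l i)) * v i - l i ^ 2 * A i.succ v) /
          (4 * (l i * (1 - insiderAlpha l i.succ * l i)) ^ 2)) ∧
      ∀ i v, U v i = -((1 - 2 * (insiderAlpha l i.succ * l i) +
          2 * (insiderAlpha l i.succ * l i) ^ 2) * v i + l i ^ 2 * A i.succ v) /
        (2 * Δ * (l i * (1 - insiderAlpha l i.succ * l i)) ^ 2) := by
  have step : ∀ (i : Fin N) (A' : EuclideanSpace ℝ (Fin N) →L[ℝ] ℝ),
      HasStrictFDerivAt (fun z => insiderAlpha z i.succ) A' l →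
      ∃ A'' : EuclideanSpace ℝ (Fin N) →L[ℝ] ℝ,
        HasStrictFDerivAt (fun z => insiderAlpha z i.castSucc) A'' l ∧
        ∀ v, A'' v = -((1 - 2 * (insiderAlpha l i.succ * l i)) * v i - l i ^ 2 * A' v) /
          (4 * (l i * (1 - insiderAlpha l i.succ * l i)) ^ 2) := by
    intro i A' hA'
    have hx := EuclideanSpace.hasStrictFDerivAt_coord i l
    obtain ⟨h1, h2⟩ := hl i
    have h := (hasStrictFDerivAt_const (1 : ℝ) l).fun_real_div
      ((hx.const_mul 4).mul ((hA'.mul hx).const_sub 1))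
      (mul_ne_zero (mul_ne_zero four_ne_zero h1) h2)
    have e : (fun z => insiderAlpha z i.castSucc) = fun z : EuclideanSpace ℝ (Fin N) =>
        1 / (4 * z i * (1 - insiderAlpha z i.succ * z i)) :=
      funext fun z => insiderAlpha_castSucc z i
    rw [e]
    refine ⟨_, h, fun v => ?_⟩
    simp
    field_simp
    ring
  -- Only existence is carried through the induction; the recursion for the chosen derivatives
  -- follows at the end from uniqueness of derivatives.
  have ex : ∀ j, ∃ A' : EuclideanSpace ℝ (Fin N) →L[ℝ] ℝ,
      HasStrictFDerivAt (fun z => insiderAlpha z j) A' l := by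
    intro j
    induction j using Fin.reverseInduction with
    | last => exact ⟨0, by simpa using hasStrictFDerivAt_const (0 : ℝ) l⟩
    | cast i ih =>
      obtain ⟨A', hA'⟩ := ih
      obtain ⟨A'', hA'', -⟩ := step i A' hA'
      exact ⟨A'', hA''⟩
  choose A hA using ex
  have exU : ∀ i : Fin N, ∃ U' : EuclideanSpace ℝ (Fin N) →L[ℝ] ℝ,
      HasStrictFDerivAt (fun z => insiderResponse Δ z i) U' l ∧
      ∀ v, U' v = -((1 - 2 * (insiderAlpha l i.succ * l i) +
          2 * (insiderAlpha l i.succ * l i) ^ 2) * v i + l i ^ 2 * A i.succ v) /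
        (2 * Δ * (l i * (1 - insiderAlpha l i.succ * l i)) ^ 2) := by
    intro i
    have hx := EuclideanSpace.hasStrictFDerivAt_coord i l
    obtain ⟨h1, h2⟩ := hl i
    have h := (((hA i.succ).const_mul 2).mul hx).const_sub 1 |>.fun_real_div
      ((hx.const_mul (Δ * 2)).mul (((hA i.succ).mul hx).const_sub 1))
      (mul_ne_zero (mul_ne_zero (by positivity) h1) h2)
    refine ⟨_, h, ?_⟩
    intro v
    simp
    field_simp
    ring
  choose U' hU' hU'' using exU
  obtain ⟨U, hU, hUv⟩ := exists_hasStrictFDerivAt_of_coord hU'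
  refine ⟨A, U, hU, hA, ?_, ?_, fun i v => (hUv v i).trans (hU'' i v)⟩
  · have h := hA (Fin.last N)
    simp only [insiderAlpha_last] at h
    exact h.hasFDerivAt.unique (hasFDerivAt_const (0 : ℝ) l)
  · intro i v
    obtain ⟨A'', h1, h2⟩ := step i _ (hA i.succ)
    rw [(hA i.castSucc).hasFDerivAt.unique h1.hasFDerivAt, h2]

/-- The derivative of the market makers' response, described by the linearized forward recursion. -/
theorem exists_hasStrictFDerivAt_marketResponse {Δ σ S0 : ℝ} (hΔ : 0 < Δ) (hσ : 0 < σ)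
    (hS : 0 < S0) (b : EuclideanSpace ℝ (Fin N)) :
    ∃ (s : Fin (N + 1) → EuclideanSpace ℝ (Fin N) →L[ℝ] ℝ)
      (L : EuclideanSpace ℝ (Fin N) →L[ℝ] EuclideanSpace ℝ (Fin N)),
      HasStrictFDerivAt (marketResponse Δ σ S0) L b ∧
      (∀ j, HasStrictFDerivAt (fun z => marketSigma Δ σ S0 z j) (s j) b) ∧ s 0 = 0 ∧
      (∀ i v, s i.succ v = σ ^ 2 * (σ ^ 2 * s i.castSucc v -
          2 * b i * marketSigma Δ σ S0 b i.castSucc ^ 2 * Δ * v i) /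
        (b i ^ 2 * marketSigma Δ σ S0 b i.castSucc * Δ + σ ^ 2) ^ 2) ∧
      ∀ i v, L v i = (marketSigma Δ σ S0 b i.castSucc *
          (σ ^ 2 - b i ^ 2 * marketSigma Δ σ S0 b i.castSucc * Δ) * v i +
          b i * σ ^ 2 * s i.castSucc v) /
        (b i ^ 2 * marketSigma Δ σ S0 b i.castSucc * Δ + σ ^ 2) ^ 2 := by
  have hden : ∀ i : Fin N, 0 < b i ^ 2 * marketSigma Δ σ S0 b i.castSucc * Δ + σ ^ 2 := by
    intro i
    have := marketSigma_pos hΔ hσ hS b i.castSucc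
    positivity
  have hden' : ∀ (i : Fin N) (s' : EuclideanSpace ℝ (Fin N) →L[ℝ] ℝ),
      HasStrictFDerivAt (fun z => marketSigma Δ σ S0 z i.castSucc) s' b →
      ∃ d : EuclideanSpace ℝ (Fin N) →L[ℝ] ℝ, HasStrictFDerivAt
        (fun z : EuclideanSpace ℝ (Fin N) => z i ^ 2 * marketSigma Δ σ S0 z i.castSucc * Δ + σ ^ 2)
          d b ∧ ∀ v, d v = (2 * b i * v i * marketSigma Δ σ S0 b i.castSucc + b i ^ 2 * s' v) * Δ := by
    intro i s' hs'
    have hx := EuclideanSpace.hasStrictFDerivAt_coord i b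
    refine ⟨_, (((hx.pow 2).mul hs').mul_const Δ).add_const (σ ^ 2), fun v => ?_⟩
    simp
    ring
  have step : ∀ (i : Fin N) (s' : EuclideanSpace ℝ (Fin N) →L[ℝ] ℝ),
      HasStrictFDerivAt (fun z => marketSigma Δ σ S0 z i.castSucc) s' b →
      ∃ s'' : EuclideanSpace ℝ (Fin N) →L[ℝ] ℝ,
        HasStrictFDerivAt (fun z => marketSigma Δ σ S0 z i.succ) s'' b ∧
        ∀ v, s'' v = σ ^ 2 * (σ ^ 2 * s' v -
          2 * b i * marketSigma Δ σ S0 b i.castSucc ^ 2 * Δ * v i) /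
        (b i ^ 2 * marketSigma Δ σ S0 b i.castSucc * Δ + σ ^ 2) ^ 2 := by
    intro i s' hs'
    obtain ⟨d, hd, hdv⟩ := hden' i s' hs'
    have h := (hs'.mul_const (σ ^ 2)).fun_real_div hd (hden i).ne'
    simp only [← marketSigma_succ] at h
    refine ⟨_, h, fun v => ?_⟩
    simp [hdv]
    field_simp
    ring
  have ex : ∀ j, ∃ s' : EuclideanSpace ℝ (Fin N) →L[ℝ] ℝ,
      HasStrictFDerivAt (fun z => marketSigma Δ σ S0 z j) s' b := by
    intro j
    induction j using Fin.induction with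
    | zero => exact ⟨0, by simpa using hasStrictFDerivAt_const S0 b⟩
    | succ i ih =>
      obtain ⟨s', hs'⟩ := ih
      obtain ⟨s'', hs'', -⟩ := step i s' hs'
      exact ⟨s'', hs''⟩
  choose s hs using ex
  have exL : ∀ i : Fin N, ∃ L' : EuclideanSpace ℝ (Fin N) →L[ℝ] ℝ,
      HasStrictFDerivAt (fun z => marketResponse Δ σ S0 z i) L' b ∧
      ∀ v, L' v = (marketSigma Δ σ S0 b i.castSucc *
          (σ ^ 2 - b i ^ 2 * marketSigma Δ σ S0 b i.castSucc * Δ) * v i +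
          b i * σ ^ 2 * s i.castSucc v) /
        (b i ^ 2 * marketSigma Δ σ S0 b i.castSucc * Δ + σ ^ 2) ^ 2 := by
    intro i
    have hx := EuclideanSpace.hasStrictFDerivAt_coord i b
    obtain ⟨d, hd, hdv⟩ := hden' i _ (hs i.castSucc)
    have h := (hx.mul (hs i.castSucc)).fun_real_div hd (hden i).ne'
    refine ⟨_, h, fun v => ?_⟩
    simp [hdv]
    field_simp
    ring
  choose L' hL' hL'' using exL
  obtain ⟨L, hL, hLv⟩ := exists_hasStrictFDerivAt_of_coord hL'
  refine ⟨s, L, hL, hs, ?_, ?_, fun i v => (hLv v i).trans (hL'' i v)⟩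
  · have h := hs 0
    simp only [marketSigma_zero] at h
    exact h.hasFDerivAt.unique (hasFDerivAt_const S0 b)
  · intro i v
    obtain ⟨s'', h1, h2⟩ := step i _ (hs i.castSucc)
    rw [(hs i.succ).hasFDerivAt.unique h1.hasFDerivAt, h2]

theorem continuousAt_insiderAlpha {l : EuclideanSpace ℝ (Fin N)} (hl : l ∈ policyDomain N)
    (j : Fin (N + 1)) : ContinuousAt (fun z => insiderAlpha z j) l := by
  obtain ⟨A, U, -, hA, -⟩ := exists_hasStrictFDerivAt_insiderResponse one_pos hl
  exact (hA j).continuousAt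

theorem isOpen_policyDomain : IsOpen (policyDomain N) := by
  rw [isOpen_iff_mem_nhds]
  intro l hl
  have h : ∀ i : Fin N, ∀ᶠ z in nhds l, z i ≠ 0 ∧ 1 - insiderAlpha z i.succ * z i ≠ 0 := by
    intro i
    have hx := (EuclideanSpace.hasStrictFDerivAt_coord i l).continuousAt
    exact (hx.eventually_ne (hl i).1).and ((continuousAt_const.sub
      ((continuousAt_insiderAlpha hl i.succ).mul hx)).eventually_ne (hl i).2)
  exact Filter.eventually_all.2 h

theorem continuousOn_policyMap {Δ σ S0 : ℝ} (hΔ : 0 < Δ) (hσ : 0 < σ) (hS : 0 < S0) :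
    ContinuousOn (policyMap (N := N) Δ σ S0) (policyDomain N) := by
  intro l hl
  obtain ⟨A, U, hU, -⟩ := exists_hasStrictFDerivAt_insiderResponse hΔ hl
  obtain ⟨s, L, hL, -⟩ := exists_hasStrictFDerivAt_marketResponse hΔ hσ hS (insiderResponse Δ l)
  exact (hL.comp l hU).continuousAt.continuousWithinAt

/-- The derivative is triangular when read backwards in time, and its diagonal never vanishes
because `1 - 2x + 2x²` has no real root. The inverse function theorem applies at every point of the
domain. -/
theorem map_nhds_insiderResponse {Δ : ℝ} (hΔ : 0 < Δ) {l : EuclideanSpace ℝ (Fin N)}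
    (hl : l ∈ policyDomain N) :
    Filter.map (insiderResponse Δ) (nhds l) = nhds (insiderResponse Δ l) := by
  obtain ⟨A, U, hU, -, hA0, hA, hUv⟩ := exists_hasStrictFDerivAt_insiderResponse hΔ hl
  refine hU.map_nhds_eq_of_surj (LinearMap.range_eq_top.2
    (LinearMap.injective_iff_surjective.1 ?_))
  rw [← LinearMap.ker_eq_bot, LinearMap.ker_eq_bot']
  intro v hv
  have key : ∀ i : Fin N, A i.succ v = 0 → v i = 0 := by
    intro i hi
    have h1 := hUv i v
    have h2 : U v i = 0 := by
      have : U v = 0 := hv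
      simp [this]
    obtain ⟨h3, h4⟩ := hl i
    rw [h2, hi, eq_comm, div_eq_zero_iff, or_iff_left (by positivity)] at h1
    have h5 : 0 < 1 - 2 * (insiderAlpha l i.succ * l i) +
        2 * (insiderAlpha l i.succ * l i) ^ 2 := by
      nlinarith [sq_nonneg (2 * (insiderAlpha l i.succ * l i) - 1)]
    have h6 : (1 - 2 * (insiderAlpha l i.succ * l i) +
        2 * (insiderAlpha l i.succ * l i) ^ 2) * v i = 0 := by linarith
    exact (mul_eq_zero.1 h6).resolve_left h5.ne'
  have hA' : ∀ j, A j v = 0 := by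
    intro j
    induction j using Fin.reverseInduction with
    | last => simp [hA0]
    | cast i ih => rw [hA, ih, key i ih]; simp
  ext i
  exact key i (hA' i.succ)

/-- Here the derivative is triangular forwards in time, with diagonal entries proportional to `σ² -
βₙ² Σₙ₋₁ Δ`. The equilibrium itself is excluded by `hb`, since `a_N = 1`. -/
theorem map_nhds_marketResponse {Δ σ S0 : ℝ} (hΔ : 0 < Δ) (hσ : 0 < σ) (hS : 0 < S0)
    {b : EuclideanSpace ℝ (Fin N)}
    (hb : ∀ i : Fin N, b i ^ 2 * marketSigma Δ σ S0 b i.castSucc * Δ ≠ σ ^ 2) :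
    Filter.map (marketResponse Δ σ S0) (nhds b) = nhds (marketResponse Δ σ S0 b) := by
  obtain ⟨s, L, hL, -, hs0, hs, hLv⟩ := exists_hasStrictFDerivAt_marketResponse hΔ hσ hS b
  refine hL.map_nhds_eq_of_surj (LinearMap.range_eq_top.2
    (LinearMap.injective_iff_surjective.1 ?_))
  rw [← LinearMap.ker_eq_bot, LinearMap.ker_eq_bot']
  intro v hv
  have key : ∀ i : Fin N, s i.castSucc v = 0 → v i = 0 := by
    intro i hi
    have h1 := hLv i v
    have h2 : L v i = 0 := by
      have : L v = 0 := hv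
      simp [this]
    have h3 := marketSigma_pos hΔ hσ hS b i.castSucc
    rw [h2, hi, eq_comm, div_eq_zero_iff, or_iff_left (by positivity), mul_zero, add_zero] at h1
    exact (mul_eq_zero.1 h1).resolve_left (mul_ne_zero h3.ne' (sub_ne_zero.2 (hb i).symm))
  have hs' : ∀ j, s j v = 0 := by
    intro j
    induction j using Fin.induction with
    | zero => simp [hs0]
    | succ i ih => rw [hs, ih, key i ih]; simp
  ext i
  exact key i (hs' i.castSucc)

/-- `Σₙ` only depends on the intensities `β₁, …, βₙ`. -/
theorem marketSigma_congr {Δ σ S0 : ℝ} {b b' : EuclideanSpace ℝ (Fin N)} (j : Fin (N + 1))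
    (h : ∀ i : Fin N, i.castSucc < j → b i = b' i) :
    marketSigma Δ σ S0 b j = marketSigma Δ σ S0 b' j := by
  induction j using Fin.induction with
  | zero => simp
  | succ i ih =>
    rw [marketSigma_succ, marketSigma_succ, h i (Fin.castSucc_lt_succ),
      ih fun k hk => h k (hk.trans (Fin.castSucc_lt_succ))]

theorem dense_noncritical {Δ σ S0 : ℝ} (hΔ : 0 < Δ) (hσ : 0 < σ) (hS : 0 < S0) :
    Dense {b : EuclideanSpace ℝ (Fin N) |
      ∀ i : Fin N, b i ^ 2 * marketSigma Δ σ S0 b i.castSucc * Δ ≠ σ ^ 2} := by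
  rw [Set.ofPred_forall]
  refine dense_iInter_of_isOpen (fun i => ?_) (fun i => ?_)
  · have h1 : Continuous fun b : EuclideanSpace ℝ (Fin N) =>
        b i ^ 2 * marketSigma Δ σ S0 b i.castSucc * Δ := by
      have h2 : Continuous fun b : EuclideanSpace ℝ (Fin N) =>
          marketSigma Δ σ S0 b i.castSucc := by
        rw [continuous_iff_continuousAt]
        intro b
        obtain ⟨s, L, -, hs, -⟩ := exists_hasStrictFDerivAt_marketResponse hΔ hσ hS b
        exact (hs _).continuousAt
      fun_prop
    exact isOpen_ne_fun h1 continuous_const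
  · rw [dense_iff_closure_eq, Set.eq_univ_iff_forall]
    intro b
    by_cases hb : b i ^ 2 * marketSigma Δ σ S0 b i.castSucc * Δ = σ ^ 2
    -- Scaling the single intensity `b i` by `1 + t` leaves the preceding variance unchanged and
    -- multiplies the critical quantity by `(1 + t)²`.
    · let γ : ℝ → EuclideanSpace ℝ (Fin N) := fun t => b + EuclideanSpace.single i (t * b i)
      have hγ0 : Filter.Tendsto γ (nhdsWithin 0 (Set.Ioi 0)) (nhds b) := by
        have h1 : Continuous γ := by
          have : γ = fun t => b + t • EuclideanSpace.single i (b i) := by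
            ext t j
            by_cases hj : j = i <;> simp [γ, hj]
          rw [this]
          fun_prop
        have h2 := h1.tendsto 0
        have h3 : γ 0 = b := by simp [γ]
        rw [h3] at h2
        exact h2.mono_left nhdsWithin_le_nhds
      refine mem_closure_of_tendsto hγ0 ?_
      filter_upwards [self_mem_nhdsWithin] with t ht
      have ht : 0 < t := ht
      have h1 : marketSigma Δ σ S0 (γ t) i.castSucc = marketSigma Δ σ S0 b i.castSucc := by
        apply marketSigma_congr
        intro k hk
        have : k ≠ i := by rintro rfl; exact lt_irrefl _ hk
        simp [γ, this]
      have h2 : γ t i = (1 + t) * b i := by simp [γ]; ring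
      change γ t i ^ 2 * marketSigma Δ σ S0 (γ t) i.castSucc * Δ ≠ σ ^ 2
      rw [h1, h2]
      have h3 : ((1 + t) * b i) ^ 2 * marketSigma Δ σ S0 b i.castSucc * Δ =
          (1 + t) ^ 2 * σ ^ 2 := by rw [← hb]; ring
      rw [h3]
      nlinarith [mul_pos ht (pow_pos hσ 2), mul_pos (mul_pos ht ht) (pow_pos hσ 2)]
    · exact subset_closure hb

theorem interior_policyMap_image_nonempty {Δ σ S0 : ℝ} (hΔ : 0 < Δ) (hσ : 0 < σ) (hS : 0 < S0)
    {O : Set (EuclideanSpace ℝ (Fin N))} (hOD : O ⊆ policyDomain N) (hO : IsOpen O)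
    (hne : O.Nonempty) : (interior (policyMap Δ σ S0 '' O)).Nonempty := by
  have hV : IsOpen (insiderResponse Δ '' O) := by
    rw [isOpen_iff_mem_nhds]
    rintro _ ⟨l, hl, rfl⟩
    rw [← map_nhds_insiderResponse hΔ (hOD hl)]
    exact Filter.image_mem_map (hO.mem_nhds hl)
  obtain ⟨b, hb, hbV⟩ := (dense_noncritical hΔ hσ hS).exists_mem_open hV (hne.image _)
  refine ⟨marketResponse Δ σ S0 b, ?_⟩
  rw [mem_interior_iff_mem_nhds, ← map_nhds_marketResponse hΔ hσ hS hb]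
  have h := Filter.image_mem_map (m := marketResponse Δ σ S0) (hV.mem_nhds hbV)
  rwa [Set.image_image] at h

end Responses

/-! ### The determinant of the linearized iteration. -/

section Determinant

variable {M : ℕ}

theorem LinearMap.det_eq_prod_of_upperTriangular {G : (Fin M → ℝ) →ₗ[ℝ] (Fin M → ℝ)}
    (h : ∀ i j, j < i → G (Pi.single j 1) i = 0) :
    LinearMap.det G = ∏ i, G (Pi.single i 1) i := by
  rw [← LinearMap.det_toMatrix', Matrix.det_of_isUpperTriangular]
  · simp [LinearMap.toMatrix'_apply]
  · intro i j hij
    have := h i j hij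
    simpa [LinearMap.toMatrix'_apply] using this

theorem LinearMap.det_eq_prod_of_lowerTriangular {G : (Fin M → ℝ) →ₗ[ℝ] (Fin M → ℝ)}
    (h : ∀ i j, i < j → G (Pi.single j 1) i = 0) :
    LinearMap.det G = ∏ i, G (Pi.single i 1) i := by
  rw [← LinearMap.det_toMatrix', Matrix.det_of_isLowerTriangular]
  · simp [LinearMap.toMatrix'_apply]
  · intro i j hij
    have := h i j (by simpa using hij)
    simpa [LinearMap.toMatrix'_apply] using this

/-- The linearization of the policy iteration at the equilibrium, on the relative variations `y` of
the intensities `β₁, …, β_M` where `M = N - 1`: `s` is the relative variation of the variances,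
`l` the one of the new price impacts, `A` the one of the insider's value function coefficients, and
`B` is the relative variation of the insider's response. The parameters are
`aₙ = βₙ² Σₙ₋₁ Δ / σ²`. -/
structure IsLinearizedIteration (a : Fin M → ℝ) (s : Fin (M + 1) → (Fin M → ℝ) →ₗ[ℝ] ℝ)
    (l : (Fin M → ℝ) →ₗ[ℝ] (Fin M → ℝ)) (A : Fin (M + 1) → (Fin M → ℝ) →ₗ[ℝ] ℝ)
    (B : (Fin M → ℝ) →ₗ[ℝ] (Fin M → ℝ)) : Prop where
  s_zero : s 0 = 0
  s_succ : ∀ i y, s i.succ y = (s i.castSucc y - 2 * a i * y i) / (1 + a i)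
  l_eq : ∀ i y, l y i = ((1 - a i) * y i + s i.castSucc y) / (1 + a i)
  A_last : ∀ y, A (Fin.last M) y = -s (Fin.last M) y / 2
  A_castSucc : ∀ i y, A i.castSucc y = ((1 - a i) * A i.succ y - 2 * a i * l y i) / (1 + a i)
  B_eq : ∀ i y, B y i = -((1 + a i ^ 2) / (a i * (1 + a i)) * l y i +
    (1 - a i) / (a i * (1 + a i)) * A i.succ y)

/-- The terminal value of `A` enters `B` as a rank-one perturbation of a product of two triangular
maps `G` and `l`. Solving for its direction writes `B` as `G ∘ l` after a transvection, whose
determinant is at least one by a sign argument; the diagonals of `G` and `l` give the product. -/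
theorem IsLinearizedIteration.prod_le_abs_det {a : Fin M → ℝ}
    {s : Fin (M + 1) → (Fin M → ℝ) →ₗ[ℝ] ℝ} {l : (Fin M → ℝ) →ₗ[ℝ] (Fin M → ℝ)}
    {A : Fin (M + 1) → (Fin M → ℝ) →ₗ[ℝ] ℝ} {B : (Fin M → ℝ) →ₗ[ℝ] (Fin M → ℝ)}
    (h : IsLinearizedIteration a s l A B) (ha0 : ∀ i, 0 < a i) (ha1 : ∀ i, a i < 1) :
    ∏ i, (1 + a i ^ 2) / (a i * (1 + a i)) * ((1 - a i) / (1 + a i)) ≤ |LinearMap.det B| := by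
  have hp : ∀ i, 0 < 1 + a i := fun i => by linarith [ha0 i]
  have hm : ∀ i, 0 < 1 - a i := fun i => by linarith [ha1 i]
  -- the value function coefficients with zero terminal value, and those without price impacts
  let A₀ : Fin (M + 1) → (Fin M → ℝ) →ₗ[ℝ] ℝ := fun j =>
    Fin.reverseInduction (motive := fun _ => (Fin M → ℝ) →ₗ[ℝ] ℝ) 0
      (fun i t => (1 + a i)⁻¹ • ((1 - a i) • t - (2 * a i) • LinearMap.proj i)) j
  have hA₀l : A₀ (Fin.last M) = 0 := by simp [A₀]
  have hA₀ : ∀ i v, A₀ i.castSucc v = ((1 - a i) * A₀ i.succ v - 2 * a i * v i) / (1 + a i) := by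
    intro i v
    have : A₀ i.castSucc = (1 + a i)⁻¹ • ((1 - a i) • A₀ i.succ - (2 * a i) • LinearMap.proj i) := by
      simp [A₀]
    rw [this, div_eq_inv_mul]
    simp
  let t : Fin (M + 1) → ℝ := fun j => Fin.reverseInduction (motive := fun _ => ℝ) 1
    (fun i x => (1 - a i) * x / (1 + a i)) j
  have htl : t (Fin.last M) = 1 := by simp [t]
  have ht : ∀ i : Fin M, t i.castSucc = (1 - a i) * t i.succ / (1 + a i) := by
    intro i; simp [t]
  have hAdec : ∀ j y, A j y = A₀ j (l y) + t j * A (Fin.last M) y := by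
    intro j y
    induction j using Fin.reverseInduction with
    | last => simp [hA₀l, htl]
    | cast i ih =>
      rw [h.A_castSucc, hA₀, ih, ht]
      ring
  let G : (Fin M → ℝ) →ₗ[ℝ] (Fin M → ℝ) := LinearMap.pi fun i =>
    -(((1 + a i ^ 2) / (a i * (1 + a i))) • LinearMap.proj i +
      ((1 - a i) / (a i * (1 + a i))) • A₀ i.succ)
  have hG : ∀ v i, G v i = -((1 + a i ^ 2) / (a i * (1 + a i)) * v i +
      (1 - a i) / (a i * (1 + a i)) * A₀ i.succ v) := fun v i => by simp [G]
  -- Back substitution in `G w = (rank-one direction)`: the unknown `k = t - A₀ w` satisfies a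
  -- recursion with positive coefficients, so `w` is positive.
  let k : Fin (M + 1) → ℝ := fun j => Fin.reverseInduction (motive := fun _ => ℝ) 1
    (fun i x => ((1 - a i) * x + 2 * a i * ((1 - a i) / (1 + a i ^ 2) * x)) / (1 + a i)) j
  have hkl : k (Fin.last M) = 1 := by simp [k]
  have hk : ∀ i : Fin M, k i.castSucc = ((1 - a i) * k i.succ +
      2 * a i * ((1 - a i) / (1 + a i ^ 2) * k i.succ)) / (1 + a i) := by
    intro i; simp [k]
  have hkp : ∀ j, 0 < k j := by
    intro j
    induction j using Fin.reverseInduction with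
    | last => simp [hkl]
    | cast i ih =>
      rw [hk]
      have := ha0 i
      have := hp i
      have := hm i
      positivity
  let w : Fin M → ℝ := fun i => (1 - a i) / (1 + a i ^ 2) * k i.succ
  have hw0 : ∀ i, 0 < w i := fun i =>
    mul_pos (div_pos (hm i) (by positivity)) (hkp _)
  have hkw : ∀ j, A₀ j w = t j - k j := by
    intro j
    induction j using Fin.reverseInduction with
    | last => simp [hA₀l, htl, hkl]
    | cast i ih =>
      rw [hA₀, ih, ht, hk]
      simp only [w]
      ring
  have hGw : ∀ i, G w i = -((1 - a i) / (a i * (1 + a i)) * t i.succ) := by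
    intro i
    rw [hG, hkw]
    have := ha0 i
    have := hp i
    have h2 : 0 < 1 + a i ^ 2 := by positivity
    simp only [w]
    field_simp
    ring
  -- Forward substitution in `l Y = w`, with `S` the resulting values of `s` at `Y`. Positivity of
  -- `w` forces `S ≤ 0`, so `A (Fin.last M) Y = -S / 2` is nonnegative.
  let S : Fin (M + 1) → ℝ := fun j => Fin.induction (motive := fun _ => ℝ) 0
    (fun i x => (x - 2 * a i * (((1 + a i) * w i - x) / (1 - a i))) / (1 + a i)) j
  have hS0 : S 0 = 0 := by simp [S]
  have hS : ∀ i : Fin M, S i.succ =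
      (S i.castSucc - 2 * a i * (((1 + a i) * w i - S i.castSucc) / (1 - a i))) / (1 + a i) := by
    intro i; simp [S]
  let Y : Fin M → ℝ := fun i => ((1 + a i) * w i - S i.castSucc) / (1 - a i)
  have hSn : ∀ j, S j ≤ 0 := by
    intro j
    induction j using Fin.induction with
    | zero => simp [hS0]
    | succ i ih =>
      rw [hS]
      have h1 := hw0 i
      have h2 := hp i
      have h3 : 0 ≤ 2 * a i * (((1 + a i) * w i - S i.castSucc) / (1 - a i)) := by
        have h4 : 0 ≤ (1 + a i) * w i - S i.castSucc := by nlinarith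
        have := ha0 i
        have := hm i
        positivity
      exact div_nonpos_of_nonpos_of_nonneg (by linarith) h2.le
  have hsY : ∀ j, s j Y = S j := by
    intro j
    induction j using Fin.induction with
    | zero => simp [h.s_zero, hS0]
    | succ i ih => rw [h.s_succ, ih, hS]
  have hlY : l Y = w := by
    ext i
    rw [h.l_eq, hsY]
    have := (hp i).ne'
    have := (hm i).ne'
    simp only [Y]
    field_simp
    ring
  have hBdec : B = G ∘ₗ l ∘ₗ LinearMap.transvection (A (Fin.last M)) Y := by
    ext1 j
    ext i
    set y := LinearMap.single ℝ (fun _ : Fin M => ℝ) j 1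
    simp only [LinearMap.comp_apply, LinearMap.transvection.apply, map_add, map_smul, hlY,
      Pi.add_apply, Pi.smul_apply, hGw, smul_eq_mul]
    rw [h.B_eq, hG, hAdec i.succ]
    ring
  have hdet : LinearMap.det B =
      LinearMap.det G * (LinearMap.det l * (1 + A (Fin.last M) Y)) := by
    rw [hBdec, LinearMap.det_comp, LinearMap.det_comp, LinearMap.transvection.det]
  have hA₀z : ∀ (j : Fin (M + 1)) (v : Fin M → ℝ), (∀ i : Fin M, j ≤ i.castSucc → v i = 0) →
      A₀ j v = 0 := by
    intro j v hv
    induction j using Fin.reverseInduction with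
    | last => simp [hA₀l]
    | cast i ih =>
      rw [hA₀, hv i le_rfl, ih fun k hk => hv k ((Fin.castSucc_lt_succ).le.trans hk)]
      simp
  have hsz : ∀ (j : Fin (M + 1)) (v : Fin M → ℝ), (∀ i : Fin M, i.castSucc < j → v i = 0) →
      s j v = 0 := by
    intro j v hv
    induction j using Fin.induction with
    | zero => simp [h.s_zero]
    | succ i ih =>
      rw [h.s_succ, hv i (Fin.castSucc_lt_succ),
        ih fun k hk => hv k (hk.trans (Fin.castSucc_lt_succ))]
      simp
  have hGdet : LinearMap.det G = ∏ i, -((1 + a i ^ 2) / (a i * (1 + a i))) := by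
    rw [LinearMap.det_eq_prod_of_upperTriangular]
    · refine Finset.prod_congr rfl fun i _ => ?_
      rw [hG, hA₀z]
      · simp
      · intro k hk
        have : k ≠ i := by
          rintro rfl
          exact absurd (Fin.castSucc_lt_succ) (not_lt.2 hk)
        simp [this]
    · intro i j hij
      rw [hG, hA₀z]
      · simp [hij.ne']
      · intro k hk
        have : k ≠ j := by
          rintro rfl
          exact absurd ((Fin.castSucc_lt_castSucc_iff.2 hij).trans Fin.castSucc_lt_succ)
            (not_lt.2 hk)
        simp [this]
  have hldet : LinearMap.det l = ∏ i, (1 - a i) / (1 + a i) := by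
    rw [LinearMap.det_eq_prod_of_lowerTriangular]
    · refine Finset.prod_congr rfl fun i _ => ?_
      rw [h.l_eq, hsz]
      · simp
      · intro k hk
        have : k ≠ i := by
          rintro rfl
          exact lt_irrefl _ hk
        simp [this]
    · intro i j hij
      rw [h.l_eq, hsz]
      · simp [hij.ne]
      · intro k hk
        have : k ≠ j := by
          rintro rfl
          exact absurd (Fin.castSucc_lt_castSucc_iff.1 hk) (not_lt.2 hij.le)
        simp [this]
  have hq : 0 ≤ A (Fin.last M) Y := by
    rw [h.A_last, hsY]
    linarith [hSn (Fin.last M)]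
  rw [hdet, ← mul_assoc, abs_mul, hGdet, hldet, ← Finset.prod_mul_distrib, Finset.abs_prod]
  have he : ∀ i, |-((1 + a i ^ 2) / (a i * (1 + a i))) * ((1 - a i) / (1 + a i))| =
      (1 + a i ^ 2) / (a i * (1 + a i)) * ((1 - a i) / (1 + a i)) := by
    intro i
    have := ha0 i
    have := hp i
    have := hm i
    rw [neg_mul, abs_neg, abs_of_nonneg (by positivity)]
  simp only [he]
  rw [abs_of_nonneg (by linarith : 0 ≤ 1 + A (Fin.last M) Y)]
  refine le_mul_of_one_le_right (Finset.prod_nonneg fun i _ => ?_) (by linarith)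
  rw [← he]
  exact abs_nonneg _

/-- The recursion for the parameters `aₙ = βₙ² Σₙ₋₁ Δ / σ²` of the equilibrium. -/
structure IsKyleSequence (a : Fin (M + 1) → ℝ) : Prop where
  last : a (Fin.last M) = 1
  pos : ∀ i, 0 < a i
  lt_one : ∀ i : Fin M, a i.castSucc < 1
  rec_eq : ∀ i : Fin M, a i.castSucc =
    a i.succ * ((1 - a i.castSucc) ^ 2 * (1 + a i.castSucc))

/-- Since `(1 - x)² (1 + x)` decreases on `[0, 1]`, a supersolution for a larger parameter bounds
the root from above. -/
theorem kyle_root_le_of_le {t x u c : ℝ} (hx0 : 0 < x) (hx1 : x < 1)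
    (hx : x = t * ((1 - x) ^ 2 * (1 + x))) (ht : t ≤ u) (hc0 : 0 ≤ c) (hc1 : c ≤ 1)
    (hc : u * ((1 - c) ^ 2 * (1 + c)) ≤ c) : x ≤ c := by
  by_contra! hcx
  have ht0 : 0 < t := by
    have hq : 0 < (1 - x) ^ 2 * (1 + x) := by
      have : 0 < 1 - x := by linarith
      positivity
    rw [hx] at hx0
    exact (pos_iff_pos_of_mul_pos hx0).2 hq
  have h1 : (1 - x) * (1 - x ^ 2) ≤ (1 - c) * (1 - c ^ 2) := by
    apply mul_le_mul <;> nlinarith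
  have h2 : t * ((1 - x) * (1 - x ^ 2)) ≤ u * ((1 - c) * (1 - c ^ 2)) := by
    apply mul_le_mul ht h1 <;> nlinarith
  nlinarith

theorem le_expansion_factor {x r : ℝ} (hx0 : 0 < x)
    (h : r * (x * (1 + x) ^ 2) ≤ (1 + x ^ 2) * (1 - x)) :
    r ≤ (1 + x ^ 2) / (x * (1 + x)) * ((1 - x) / (1 + x)) := by
  rw [div_mul_div_comm, le_div_iff₀ (by positivity)]
  linarith

/-- Only the last factor can be below one. The bound `9/20` on its parameter makes it at least
`0.69`; all earlier parameters are at most `3/10`, so their factors are at least `3/2`, and `0.69 ·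
3/2 > 1`. -/
theorem IsKyleSequence.one_lt_prod (hM : 2 ≤ M) {a : Fin (M + 1) → ℝ} (h : IsKyleSequence a) :
    1 < ∏ i : Fin M, (1 + a i.castSucc ^ 2) / (a i.castSucc * (1 + a i.castSucc)) *
      ((1 - a i.castSucc) / (1 + a i.castSucc)) := by
  obtain ⟨m, rfl⟩ := Nat.exists_eq_add_of_le' hM
  set g : ℝ → ℝ := fun x => (1 + x ^ 2) / (x * (1 + x)) * ((1 - x) / (1 + x)) with hg
  change 1 < ∏ i : Fin (m + 2), g (a i.castSucc)
  have h1 : a (Fin.last (m + 1)).castSucc ≤ 9 / 20 := by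
    refine kyle_root_le_of_le (h.pos _) (h.lt_one _) (h.rec_eq _) (u := 1) ?_ (by norm_num)
      (by norm_num) (by norm_num)
    rw [Fin.succ_last, h.last]
  have step : ∀ j : Fin (m + 1), a j.castSucc.succ ≤ 9 / 20 → a j.castSucc.castSucc ≤ 3 / 10 :=
    fun j hu => kyle_root_le_of_le (h.pos _) (h.lt_one _) (h.rec_eq _) hu (by norm_num)
      (by norm_num) (by norm_num)
  have h2 : ∀ j : Fin (m + 1), a j.castSucc.castSucc ≤ 3 / 10 := by
    intro j
    induction j using Fin.reverseInduction with
    | last => exact step _ h1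
    | cast j ih =>
      refine step _ ?_
      rw [Fin.succ_castSucc, Fin.succ_castSucc]
      exact ih.trans (by norm_num)
  have hg1 : 69 / 100 ≤ g (a (Fin.last (m + 1)).castSucc) := by
    have h0 := h.pos (Fin.last (m + 1)).castSucc
    refine le_expansion_factor h0 ?_
    generalize a (Fin.last (m + 1)).castSucc = x at *
    nlinarith [mul_pos h0 h0, mul_pos (mul_pos h0 h0) h0, mul_nonneg h0.le (sub_nonneg.2 h1),
      mul_nonneg (mul_pos h0 h0).le (sub_nonneg.2 h1)]
  have hg2 : ∀ j : Fin (m + 1), 3 / 2 ≤ g (a j.castSucc.castSucc) := by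
    intro j
    have h0 := h.pos j.castSucc.castSucc
    have h3 := h2 j
    refine le_expansion_factor h0 ?_
    generalize a j.castSucc.castSucc = x at *
    nlinarith [mul_pos h0 h0, mul_pos (mul_pos h0 h0) h0, mul_nonneg h0.le (sub_nonneg.2 h3),
      mul_nonneg (mul_pos h0 h0).le (sub_nonneg.2 h3)]
  have hg3 : 1 ≤ ∏ j : Fin m, g (a j.castSucc.castSucc.castSucc) :=
    Finset.prod_induction _ (1 ≤ ·) (fun _ _ => one_le_mul_of_one_le_of_one_le) le_rfl
      fun j _ => by linarith [hg2 j.castSucc]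
  rw [Fin.prod_univ_castSucc, Fin.prod_univ_castSucc]
  have h5 := hg2 (Fin.last m)
  calc (1 : ℝ) < 1 * (3 / 2) * (69 / 100) := by norm_num
    _ ≤ _ := by gcongr

theorem IsLinearizedIteration.exists_lt_one {a : Fin 1 → ℝ}
    {s : Fin 2 → (Fin 1 → ℝ) →ₗ[ℝ] ℝ} {l : (Fin 1 → ℝ) →ₗ[ℝ] (Fin 1 → ℝ)}
    {A : Fin 2 → (Fin 1 → ℝ) →ₗ[ℝ] ℝ} {B : (Fin 1 → ℝ) →ₗ[ℝ] (Fin 1 → ℝ)}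
    (h : IsLinearizedIteration a s l A B) (h0 : 0 < a 0) (h1 : a 0 < 1)
    (ha : a 0 = (1 - a 0) ^ 2 * (1 + a 0)) :
    ∃ κ, 0 ≤ κ ∧ κ < 1 ∧ ∀ y, |B y 0| = κ * |y 0| := by
  have hs : ∀ y, s (Fin.last 1) y = -2 * a 0 * y 0 / (1 + a 0) := by
    intro y
    have h2 := h.s_succ 0 y
    rw [Fin.castSucc_zero, h.s_zero] at h2
    rw [show Fin.last 1 = (0 : Fin 1).succ from rfl, h2]
    simp
  have hB : ∀ y, B y 0 = -((1 - a 0 ^ 3) / (a 0 * (1 + a 0) ^ 2)) * y 0 := by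
    intro y
    rw [h.B_eq, h.l_eq, show (0 : Fin 1).succ = Fin.last 1 from rfl, h.A_last, hs,
      Fin.castSucc_zero, h.s_zero]
    have : 0 < 1 + a 0 := by linarith
    simp
    field_simp
    ring
  generalize a 0 = x at *
  have hx3 : x ^ 3 = x ^ 2 + 2 * x - 1 := by linarith
  have hκ : 0 ≤ (1 - x ^ 3) / (x * (1 + x) ^ 2) :=
    div_nonneg (sub_nonneg.2 (pow_le_one₀ h0.le h1.le)) (by positivity)
  refine ⟨(1 - x ^ 3) / (x * (1 + x) ^ 2), hκ, ?_, ?_⟩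
  · rw [div_lt_one (by positivity)]
    -- Modulo the cubic equation for `x`, the claim reads `4x² + 5x > 3`. The constant `0.444`
    -- separates the positive root of that quadratic (about `0.4430`) from `x` (about `0.4450`).
    have : 111 / 250 < x := by
      by_contra! hx
      nlinarith [mul_nonneg h0.le (sub_nonneg.2 hx), mul_nonneg (mul_pos h0 h0).le (sub_nonneg.2 hx)]
    nlinarith
  · intro y
    rw [hB, abs_mul, abs_neg, abs_of_nonneg hκ]

end Determinant

/-! ### Linearization at the equilibrium and the two stability results. -/

section Equilibrium

variable {N M : ℕ} {Δ σ S0 : ℝ}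

namespace IsKyleEquilibrium

theorem insiderAlpha_lam {e : KyleCoeffs N} (h : IsKyleEquilibrium Δ σ S0 e) (j : Fin (N + 1)) :
    insiderAlpha e.lam j = e.alp j := by
  induction j using Fin.reverseInduction with
  | last => rw [insiderAlpha_last, h.alp_last]
  | cast i ih => rw [insiderAlpha_castSucc, ih, h.alp_eq]

theorem lam_mem_policyDomain {e : KyleCoeffs N} (hΔ : 0 < Δ) (hσ : 0 < σ) (hS : 0 < S0)
    (h : IsKyleEquilibrium Δ σ S0 e) : e.lam ∈ policyDomain N := by
  refine fun i => ⟨(h.lam_pos hΔ hσ hS i).ne', ?_⟩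
  rw [h.insiderAlpha_lam]
  linarith [h.second_order i]

theorem insiderResponse_lam {e : KyleCoeffs N} (h : IsKyleEquilibrium Δ σ S0 e) :
    insiderResponse Δ e.lam = e.bet := by
  ext i
  rw [h.bet_eq, ← h.insiderAlpha_lam]
  rfl

theorem marketSigma_bet {e : KyleCoeffs N} (h : IsKyleEquilibrium Δ σ S0 e) (j : Fin (N + 1)) :
    marketSigma Δ σ S0 e.bet j = e.Sig j := by
  induction j using Fin.induction with
  | zero => rw [marketSigma_zero, h.Sig_zero]
  | succ i ih => rw [marketSigma_succ, ih, h.Sig_eq]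

theorem marketResponse_bet {e : KyleCoeffs N} (h : IsKyleEquilibrium Δ σ S0 e) :
    marketResponse Δ σ S0 e.bet = e.lam := by
  ext i
  rw [h.lam_eq, ← h.marketSigma_bet]
  rfl

theorem policyMap_lam {e : KyleCoeffs N} (h : IsKyleEquilibrium Δ σ S0 e) :
    policyMap Δ σ S0 e.lam = e.lam := by
  rw [policyMap, h.insiderResponse_lam, h.marketResponse_bet]

theorem isKyleSequence {e : KyleCoeffs (M + 1)} (hΔ : 0 < Δ) (hσ : 0 < σ) (hS : 0 < S0)
    (h : IsKyleEquilibrium Δ σ S0 e) :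
    IsKyleSequence fun i : Fin (M + 1) => e.bet i ^ 2 * e.Sig i.castSucc * Δ / σ ^ 2 := by
  have hr := fun i : Fin M =>
    h.recursion hΔ hσ hS i.castSucc i.succ (Fin.succ_castSucc i) rfl rfl
  refine ⟨?_, fun i => ?_, fun i => (hr i).2.1, fun i => (hr i).2.2.2⟩
  · have h1 := h.alp_mul_lam hΔ hσ hS (Fin.last M)
    rw [Fin.succ_last, h.alp_last] at h1
    linarith
  · have := h.bet_pos i
    have := h.Sig_pos hΔ hσ hS i.castSucc
    positivity

/-- The derivative of the policy map at the equilibrium factors through the variations of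
`β₁, …, β_{N-1}`, since `λ_N` is at a critical point as a function of `β_N`. -/
theorem exists_hasStrictFDerivAt_policyMap {e : KyleCoeffs (M + 1)} (hΔ : 0 < Δ) (hσ : 0 < σ)
    (hS : 0 < S0) (h : IsKyleEquilibrium Δ σ S0 e) :
    ∃ (P : EuclideanSpace ℝ (Fin (M + 1)) →L[ℝ] (Fin M → ℝ))
      (C : (Fin M → ℝ) →L[ℝ] EuclideanSpace ℝ (Fin (M + 1))) (s : _) (l : _) (A : _),
      HasStrictFDerivAt (policyMap Δ σ S0) (C ∘L P) e.lam ∧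
      IsLinearizedIteration
        (fun i : Fin M => e.bet i.castSucc ^ 2 * e.Sig i.castSucc.castSucc * Δ / σ ^ 2) s l A
        (P ∘L C : (Fin M → ℝ) →L[ℝ] (Fin M → ℝ)) := by
  obtain ⟨A', U, hU, -, hA'l, hA', hU'⟩ :=
    exists_hasStrictFDerivAt_insiderResponse hΔ (h.lam_mem_policyDomain hΔ hσ hS)
  obtain ⟨s', L, hL, -, hs'0, hs', hL'⟩ :=
    exists_hasStrictFDerivAt_marketResponse hΔ hσ hS e.bet
  simp only [h.insiderAlpha_lam] at hA' hU'
  simp only [h.marketSigma_bet] at hs' hL'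
  set a : Fin (M + 1) → ℝ := fun i => e.bet i ^ 2 * e.Sig i.castSucc * Δ / σ ^ 2 with ha
  have hseq : IsKyleSequence a := h.isKyleSequence hΔ hσ hS
  have hbp := h.bet_pos
  have hSp := h.Sig_pos hΔ hσ hS
  have hlp := h.lam_pos hΔ hσ hS
  have hap := hseq.pos
  have hx : ∀ i, e.alp i.succ * e.lam i = (1 - a i) / 2 := h.alp_mul_lam hΔ hσ hS
  have hbS : ∀ i : Fin (M + 1), e.bet i ^ 2 * e.Sig i.castSucc * Δ = a i * σ ^ 2 := by
    intro i
    simp only [ha]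
    field_simp
  have hlam : ∀ i : Fin (M + 1), e.lam i = e.bet i * e.Sig i.castSucc / (σ ^ 2 * (1 + a i)) := by
    intro i
    rw [h.lam_eq, hbS]
    congr 1
    ring
  have hSig : ∀ i : Fin (M + 1), e.Sig i.succ = e.Sig i.castSucc / (1 + a i) := by
    intro i
    have := hap i
    rw [h.Sig_eq, hbS]
    field_simp
    ring
  have halp : ∀ i : Fin (M + 1), e.alp i.castSucc = 1 / (2 * e.lam i * (1 + a i)) := by
    intro i
    rw [h.alp_eq, hx]
    congr 1
    ring
  have hbet : ∀ i : Fin (M + 1), e.bet i = a i / (Δ * e.lam i * (1 + a i)) := by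
    intro i
    have := hap i
    have := hlp i
    rw [h.bet_eq, mul_assoc 2, hx, show 1 - 2 * ((1 - a i) / 2) = a i by ring,
      show 1 - (1 - a i) / 2 = (1 + a i) / 2 by ring]
    field_simp
  simp only [hbS] at hs' hL'
  simp only [hx] at hA' hU'
  let ins : (Fin M → ℝ) →L[ℝ] EuclideanSpace ℝ (Fin (M + 1)) :=
    ((EuclideanSpace.equiv (Fin (M + 1)) ℝ).symm : (Fin (M + 1) → ℝ) →L[ℝ] _) ∘L
      ContinuousLinearMap.pi (Fin.lastCases (motive := fun _ => (Fin M → ℝ) →L[ℝ] ℝ) 0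
        fun i => e.bet i.castSucc • ContinuousLinearMap.proj i)
  have insc : ∀ y (i : Fin M), ins y i.castSucc = e.bet i.castSucc * y i := by
    intro y i; simp [ins]
  have insl : ∀ y, ins y (Fin.last M) = 0 := by
    intro y; simp [ins]
  let P : EuclideanSpace ℝ (Fin (M + 1)) →L[ℝ] (Fin M → ℝ) := ContinuousLinearMap.pi fun i =>
    (e.bet i.castSucc)⁻¹ • ((EuclideanSpace.proj i.castSucc : _ →L[ℝ] ℝ) ∘L U)
  have hP : ∀ v i, P v i = (e.bet i.castSucc)⁻¹ * U v i.castSucc := fun v i => by simp [P]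
  let C : (Fin M → ℝ) →L[ℝ] EuclideanSpace ℝ (Fin (M + 1)) := L ∘L ins
  -- No variance up to `Σ_{N-1}` depends on `β_N`, and the coefficient `σ² - β_N² Σ_{N-1} Δ`
  -- vanishes because `a_N = 1`.
  have hker : ∀ w : EuclideanSpace ℝ (Fin (M + 1)), (∀ i : Fin M, w i.castSucc = 0) → L w = 0 := by
    intro w hw
    have h1 : ∀ j : Fin (M + 1), s' j.castSucc w = 0 := by
      intro j
      induction j using Fin.induction with
      | zero => simp [hs'0]
      | succ i ih =>
        rw [← Fin.succ_castSucc, hs', ih, hw]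
        simp
    ext i
    rw [hL', h1]
    induction i using Fin.lastCases with
    | last => rw [hseq.last]; simp
    | cast i => rw [hw]; simp
  have hcomp : L ∘L U = C ∘L P := by
    ext1 v
    have h1 := hker (U v - ins (P v)) fun i => by
      have := (hbp i.castSucc).ne'
      rw [PiLp.sub_apply, insc, hP]
      field_simp
      ring
    rw [map_sub, sub_eq_zero] at h1
    exact h1
  refine ⟨P, C, fun j => ((e.Sig j.castSucc)⁻¹ • (s' j.castSucc ∘L ins) : (Fin M → ℝ) →L[ℝ] ℝ),
    (ContinuousLinearMap.pi fun i => (e.lam i.castSucc)⁻¹ •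
      ((EuclideanSpace.proj i.castSucc : _ →L[ℝ] ℝ) ∘L C) : (Fin M → ℝ) →L[ℝ] (Fin M → ℝ)),
    fun j => ((e.alp j.castSucc)⁻¹ • (A' j.castSucc ∘L C) : (Fin M → ℝ) →L[ℝ] ℝ), ?_, ?_⟩
  · rw [← hcomp]
    rw [← h.insiderResponse_lam] at hL
    exact hL.comp e.lam hU
  have hCc : ∀ y (i : Fin M), C y i.castSucc = e.lam i.castSucc * (((1 - a i.castSucc) * y i +
      (e.Sig i.castSucc.castSucc)⁻¹ * s' i.castSucc.castSucc (ins y)) / (1 + a i.castSucc)) := by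
    intro y i
    have p1 := hap i.castSucc
    have p2 := hSp i.castSucc.castSucc
    change L (ins y) i.castSucc = _
    rw [hL', insc, hlam]
    field_simp
    ring
  have hCl : ∀ y, C y (Fin.last M) = e.lam (Fin.last M) *
      ((e.Sig (Fin.last M).castSucc)⁻¹ * s' (Fin.last M).castSucc (ins y) / 2) := by
    intro y
    have p2 := hSp (Fin.last M).castSucc
    change L (ins y) (Fin.last M) = _
    rw [hL', insl, hlam, hseq.last]
    field_simp
    ring
  constructor
  · ext y
    simp [hs'0]
  · intro i y
    have p1 := hap i.castSucc
    have p2 := hSp i.castSucc.castSucc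
    have e1 := hSig i.castSucc
    have e2 := hbS i.castSucc
    have e3 : e.bet i.castSucc * (e.Sig i.castSucc.castSucc ^ 2 * Δ * (e.bet i.castSucc * y i)) =
        a i.castSucc * σ ^ 2 * e.Sig i.castSucc.castSucc * y i := by
      rw [← e2]; ring
    simp only [ContinuousLinearMap.coe_coe, smul_apply,
      ContinuousLinearMap.comp_apply, smul_eq_mul, ← Fin.succ_castSucc]
    change _ = (_ - 2 * a i.castSucc * y i) / (1 + a i.castSucc)
    rw [hs', insc, e1]
    have e4 : σ ^ 2 * s' i.castSucc.castSucc (ins y) - 2 * e.bet i.castSucc *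
        e.Sig i.castSucc.castSucc ^ 2 * Δ * (e.bet i.castSucc * y i) =
        σ ^ 2 * (s' i.castSucc.castSucc (ins y) -
          2 * a i.castSucc * e.Sig i.castSucc.castSucc * y i) := by
      linear_combination (-2) * e3
    rw [e4]
    field_simp
    ring
  · intro i y
    have p3 := hlp i.castSucc
    simp only [ContinuousLinearMap.coe_coe, ContinuousLinearMap.pi_apply,
      smul_apply, ContinuousLinearMap.comp_apply, smul_eq_mul]
    change (e.lam i.castSucc)⁻¹ * C y i.castSucc = ((1 - a i.castSucc) * _ + _) / (1 + a i.castSucc)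
    rw [hCc]
    field_simp
  · intro y
    have p3 := hlp (Fin.last M)
    simp only [ContinuousLinearMap.coe_coe, smul_apply,
      ContinuousLinearMap.comp_apply, smul_eq_mul]
    rw [hA', halp, Fin.succ_last, hA'l, hCl, hseq.last]
    simp
    field_simp
    ring
  · intro i y
    have p1 := hap i.castSucc
    have p3 := hlp i.castSucc
    have p4 : 0 < e.alp i.succ.castSucc := by
      rw [halp]
      have := hlp i.succ
      have := hap i.succ
      positivity
    have e1 := hx i.castSucc
    rw [Fin.succ_castSucc] at e1
    -- The identity `αₙ λₙ = (1 - aₙ) / 2` converts the relative variation of `αₙ` into the absolute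
    -- one used by the derivative formula.
    have e2 : (1 - a i.castSucc) * ((e.alp i.succ.castSucc)⁻¹ * A' i.succ.castSucc (C y)) =
        2 * e.lam i.castSucc * A' i.succ.castSucc (C y) := by
      rw [show 1 - a i.castSucc = 2 * (e.alp i.succ.castSucc * e.lam i.castSucc) by linarith]
      field_simp
    simp only [ContinuousLinearMap.coe_coe, ContinuousLinearMap.pi_apply,
      smul_apply, ContinuousLinearMap.comp_apply, smul_eq_mul]
    change _ = ((1 - a i.castSucc) * _ - 2 * a i.castSucc * ((e.lam i.castSucc)⁻¹ * C y i.castSucc)) /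
      (1 + a i.castSucc)
    rw [e2, hA', halp i.castSucc, Fin.succ_castSucc,
      show 1 - 2 * ((1 - a i.castSucc) / 2) = a i.castSucc by ring,
      show 1 - (1 - a i.castSucc) / 2 = (1 + a i.castSucc) / 2 by ring]
    field_simp
    ring
  · intro i y
    have p1 := hap i.castSucc
    have p3 := hlp i.castSucc
    have p4 : 0 < e.alp i.succ.castSucc := by
      rw [halp]
      have := hlp i.succ
      have := hap i.succ
      positivity
    have e1 := hx i.castSucc
    rw [Fin.succ_castSucc] at e1
    have e2 : (1 - a i.castSucc) * ((e.alp i.succ.castSucc)⁻¹ * A' i.succ.castSucc (C y)) =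
        2 * e.lam i.castSucc * A' i.succ.castSucc (C y) := by
      rw [show 1 - a i.castSucc = 2 * (e.alp i.succ.castSucc * e.lam i.castSucc) by linarith]
      field_simp
    simp only [ContinuousLinearMap.coe_coe, ContinuousLinearMap.pi_apply,
      smul_apply, ContinuousLinearMap.comp_apply, smul_eq_mul]
    change P (C y) i = -((1 + a i.castSucc ^ 2) / (a i.castSucc * (1 + a i.castSucc)) *
      ((e.lam i.castSucc)⁻¹ * C y i.castSucc) +
      (1 - a i.castSucc) / (a i.castSucc * (1 + a i.castSucc)) * _)
    rw [div_mul_eq_mul_div (1 - a i.castSucc), e2, hP, hU', Fin.succ_castSucc, hbet,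
      show 1 - 2 * ((1 - a i.castSucc) / 2) + 2 * ((1 - a i.castSucc) / 2) ^ 2 =
        (1 + a i.castSucc ^ 2) / 2 by ring,
      show 1 - (1 - a i.castSucc) / 2 = (1 + a i.castSucc) / 2 by ring]
    field_simp

theorem isLocallyStable {e : KyleCoeffs (M + 1)} (hΔ : 0 < Δ) (hσ : 0 < σ) (hS : 0 < S0)
    (h : IsKyleEquilibrium Δ σ S0 e) (hM : M = 0 ∨ M = 1) :
    IsLocallyStable (policyDomain (M + 1)) (policyMap Δ σ S0) e.lam := by
  obtain ⟨P, C, s, l, A, hf, hlin⟩ := h.exists_hasStrictFDerivAt_policyMap hΔ hσ hS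
  refine isLocallyStable_of_norm_lt_one
    (isOpen_policyDomain.mem_nhds (h.lam_mem_policyDomain hΔ hσ hS)) (h.policyMap_lam)
    hf.hasFDerivAt ?_
  have hseq := h.isKyleSequence hΔ hσ hS
  rcases hM with rfl | rfl
  · have : P ∘L C = 0 := by
      ext y i
      exact i.elim0
    rw [this, norm_zero]
    exact one_pos
  · have h1 := hseq.rec_eq 0
    rw [show (0 : Fin 1).succ = Fin.last 1 from rfl, hseq.last, one_mul] at h1
    obtain ⟨κ, hκ0, hκ1, hκ⟩ := hlin.exists_lt_one (hseq.pos _) (hseq.lt_one 0) h1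
    -- On the one-dimensional space `Fin 1 → ℝ` the operator norm is controlled by the scalar `κ`.
    refine (ContinuousLinearMap.opNorm_le_bound _ hκ0 fun y => ?_).trans_lt hκ1
    rw [pi_norm_le_iff_of_nonneg (by positivity)]
    intro i
    rw [Subsingleton.elim i 0]
    refine (hκ y).le.trans ?_
    gcongr
    exact norm_le_pi_norm y 0

theorem not_isLocallyStable {e : KyleCoeffs (M + 1)} (hΔ : 0 < Δ) (hσ : 0 < σ) (hS : 0 < S0)
    (h : IsKyleEquilibrium Δ σ S0 e) (hM : 2 ≤ M) :
    ¬ IsLocallyStable (policyDomain (M + 1)) (policyMap Δ σ S0) e.lam := by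
  obtain ⟨P, C, s, l, A, hf, hlin⟩ := h.exists_hasStrictFDerivAt_policyMap hΔ hσ hS
  have hseq := h.isKyleSequence hΔ hσ hS
  exact not_isLocallyStable_of_one_lt_det
    (isOpen_policyDomain.mem_nhds (h.lam_mem_policyDomain hΔ hσ hS)) (h.policyMap_lam)
    (continuousOn_policyMap hΔ hσ hS)
    (fun O => interior_policyMap_image_nonempty hΔ hσ hS) hf
    ((hseq.one_lt_prod hM).trans_le (hlin.prod_le_abs_det (fun i => hseq.pos _) hseq.lt_one))

end IsKyleEquilibrium

/-! ### A second policy that reaches the equilibrium. -/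

/-- `αₙ` only depends on the price impacts `λₙ₊₁, …, λ_N`. -/
theorem insiderAlpha_congr {l l' : EuclideanSpace ℝ (Fin N)} (j : Fin (N + 1))
    (h : ∀ i : Fin N, j ≤ i.castSucc → l i = l' i) : insiderAlpha l j = insiderAlpha l' j := by
  induction j using Fin.reverseInduction with
  | last => simp
  | cast i ih =>
    rw [insiderAlpha_castSucc, insiderAlpha_castSucc, h i le_rfl,
      ih fun k hk => h k ((Fin.castSucc_lt_succ).le.trans hk)]

/-- As a function of `λ₁`, the intensity `β₁` takes its equilibrium value twice, so that a pricing
rule different from the equilibrium leads to the equilibrium in one step. -/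
theorem IsKyleEquilibrium.not_isUnstable {e : KyleCoeffs (M + 1)} (hΔ : 0 < Δ) (hσ : 0 < σ)
    (hS : 0 < S0) (h : IsKyleEquilibrium Δ σ S0 e) (hM : 1 ≤ M) :
    ¬ IsUnstable (policyDomain (M + 1)) (policyMap Δ σ S0) e.lam := by
  intro hun
  obtain ⟨m, rfl⟩ := Nat.exists_eq_add_of_le' hM
  set a := e.bet 0 ^ 2 * e.Sig (0 : Fin (m + 1 + 1)).castSucc * Δ / σ ^ 2 with ha
  have hseq := h.isKyleSequence hΔ hσ hS
  have ha0 : 0 < a := hseq.pos 0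
  have ha1 : a < 1 := hseq.lt_one 0
  have hx : e.alp (0 : Fin (m + 1 + 1)).succ * e.lam 0 = (1 - a) / 2 := h.alp_mul_lam hΔ hσ hS 0
  have hl := h.lam_pos hΔ hσ hS 0
  have hb := h.bet_eq 0
  rw [mul_assoc 2, hx] at hb
  have hdom := h.lam_mem_policyDomain hΔ hσ hS
  have hm : 0 < 1 - a := by linarith
  -- With `x = α₁ λ₁`, the intensity `β₁` is proportional to `(1 - 2x) / (x (1 - x))`. Fixing its
  -- value gives a quadratic in `x`; one root is `(1 - a) / 2`, the other `(1 + a) / (2a)`. The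
  -- latter exceeds one, so it violates the second-order condition but stays in the domain.
  set r := e.lam 0 * (1 + a) / (a * (1 - a)) with hr
  have hr0 : 0 < r := by positivity
  let x : EuclideanSpace ℝ (Fin (m + 1 + 1)) := WithLp.toLp 2 (Function.update e.lam.ofLp 0 r)
  have hx0 : x 0 = r := by simp [x]
  have hxi : ∀ i, i ≠ 0 → x i = e.lam i := fun i hi => by simp [x, hi]
  have halp : ∀ i : Fin (m + 1 + 1), insiderAlpha x i.succ = e.alp i.succ := by
    intro i
    rw [← h.insiderAlpha_lam]
    apply insiderAlpha_congr
    rintro k hk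
    apply hxi
    rintro rfl
    simp at hk
  have hαr : e.alp (0 : Fin (m + 1 + 1)).succ * r = (1 + a) / (2 * a) := by
    have : e.alp (0 : Fin (m + 1 + 1)).succ * r =
        e.alp (0 : Fin (m + 1 + 1)).succ * e.lam 0 * (1 + a) / (a * (1 - a)) := by
      rw [hr]; ring
    rw [this, hx]
    field_simp
  have hxD : x ∈ policyDomain (m + 1 + 1) := by
    intro i
    rw [halp]
    rcases eq_or_ne i 0 with rfl | hi
    · rw [hx0, hαr]
      refine ⟨hr0.ne', ?_⟩
      have : 1 - (1 + a) / (2 * a) = -((1 - a) / (2 * a)) := by field_simp; ring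
      rw [this]
      exact neg_ne_zero.2 (by positivity)
    · rw [hxi i hi]
      have := hdom i
      rwa [h.insiderAlpha_lam] at this
  have hbx : insiderResponse Δ x = e.bet := by
    ext i
    change (1 - 2 * insiderAlpha x i.succ * x i) /
      (Δ * 2 * x i * (1 - insiderAlpha x i.succ * x i)) = _
    rw [halp]
    rcases eq_or_ne i 0 with rfl | hi
    · rw [hb, mul_assoc 2, hx0, hαr, hr,
        show 1 - (1 + a) / (2 * a) = -((1 - a) / (2 * a)) by field_simp; ring,
        show 1 - 2 * ((1 + a) / (2 * a)) = -(1 / a) by field_simp; ring,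
        show 1 - 2 * ((1 - a) / 2) = a by ring, show 1 - (1 - a) / 2 = (1 + a) / 2 by ring]
      field_simp
    · rw [hxi i hi, h.bet_eq]
  have hfx : policyMap Δ σ S0 x = e.lam := by
    rw [policyMap, hbx, h.marketResponse_bet]
  have hiter : ∀ k : ℕ, (policyMap Δ σ S0)^[k + 1] x = e.lam := by
    intro k
    rw [Function.iterate_succ_apply, hfx]
    exact Function.iterate_fixed (h.policyMap_lam) k
  have hxe := hun x ⟨fun k => ?_, ?_⟩
  · have h1 : r = e.lam 0 := by rw [← hx0, hxe]
    rw [hr, div_eq_iff (by positivity)] at h1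
    have h2 := mul_left_cancel₀ hl.ne' h1
    nlinarith
  · cases k with
    | zero => exact hxD
    | succ k => rw [hiter]; exact hdom
  · rw [← Filter.tendsto_add_atTop_iff_nat 1]
    simp only [hiter]
    exact tendsto_const_nhds

end Equilibrium

theorem theoremA1 (N : ℕ) (Δ σ S0 : ℝ) (hΔ : 0 < Δ) (hσ : 0 < σ) (hS : 0 < S0) :
    (N = 1 ∨ N = 2 →
      IsLocallyStable (policyDomain N) (policyMap Δ σ S0) (kyleEquilibrium N hΔ hσ hS).lam) ∧
    (3 ≤ N →
      ¬ IsLocallyStable (policyDomain N) (policyMap Δ σ S0) (kyleEquilibrium N hΔ hσ hS).lam) ∧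
    (3 ≤ N →
      ¬ IsUnstable (policyDomain N) (policyMap Δ σ S0) (kyleEquilibrium N hΔ hσ hS).lam) := by
  have h := isKyleEquilibrium_kyleEquilibrium N hΔ hσ hS
  -- The index `M = N - 1` is the dimension of the space through which the derivative factors.
  cases N with
  | zero => exact ⟨fun hN => by omega, fun hN => by omega, fun hN => by omega⟩
  | succ M =>
    exact ⟨fun hN => h.isLocallyStable hΔ hσ hS (by omega),
      fun hN => h.not_isLocallyStable hΔ hσ hS (by omega),
      fun hN => h.not_isUnstable hΔ hσ hS (by omega)⟩
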